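/- **Model.** For $\lambda>0$ and integers $N_t,N_r\ge 1$ consider a downlink cellular network in which the base stations (BSs) form a homogeneous Poisson point process of intensity $\lambda$ in $\mathbb R^2$; $r_0\le r_1\le\dots$ are the distances of the BSs from the origin. User $0$ is at the origin and is served by the closest BS (BS $0$); BS $i$ serves user $i$. The channel from BS $i$ to user $j$ is a matrix $H_{i,j}\in\mathbb C^{N_r\times N_t}$; all entries of all these matrices are i.i.d. circularly symmetric complex Gaussian with mean $0$ and variance $1$, independent of the BS positions. With eigen-beamforming, the combining vector $u_i$ of user $i$ and the precoding vector $v_i$ of BS $i$ are unit left and right singular vectors of $H_{i,i}$ for its largest singular value (chosen by a fixed measurable rule). For a large-scale gain $L:[0,\infty)\to[0,\infty)$ and noise variance $\sigma^2\ge 0$, $$\mathrm{SINR}=\frac{L(r_0)\,|u_0^*H_{0,0}v_0|^2}{\sum_{i\ge1}L(r_i)\,|u_0^*H_{i,0}v_i|^2+\|u_0\|_2^2\sigma^2},\qquad \mathcal E=\lambda\log_2(1+\mathrm{SINR}),$$ and the average SINR and the average area spectral efficiency (ASE) are $\mathbb E[\mathrm{SINR}]$ and $\mathbb E[\mathcal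 E]$. The MISO case is $N_r=1$; write $\overline{\mathcal E}_{\rm MISO}(\lambda;N)$ for the average ASE with $N$ transmit antennas and one receive antenna. **Assumptions.** $L$ is measurable, $0<L(0)<\infty$, $L(r)\le L(0)$ for all $r\ge 0$, $0<\int_0^\infty rL(r)\,dr<\infty$, and $L$ is bounded below by a positive constant on some interval $(0,\varepsilon)$, $\varepsilon>0$ (automatic if $L$ is non-increasing, or continuous at $0$). There are $\rho\ge0$, $\zeta>0$, $\lambda_c\ge 0$ and a differentiable decreasing $\tilde L:[\rho,\infty)\to(0,\infty)$ with $\tilde L\le L$ on $[\rho,\infty)$, $r\tilde L(r)\ge-\zeta\tilde L'(r)$ for all $r\ge \rho$, and $\int_\rho^\infty \frac{r}{\tilde L(r)^2}e^{-\pi\lambda_0r^2}dr<\infty$ for all $\lambda_0>\lambda_c$. The functions $N_t,N_r:[0,\infty)\to\mathbb Z_{\ge0}$ satisfy: $N_t$ is non-decreasing, $N_t(0)=0$, $\lim_{\lambda\to\infty}N_t(\lambda)=\infty$, $N_r(\lambda)\ge1$ for all large $\lambda$, and $\lim_{\lambda\to\infty}N_r(\lambda)/N_t(\lambda)=y\in[0,1]$.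 **Corollary.** There are constants $c,C>0$ such that for all sufficiently large $\lambda$, in the network with $N_t(\lambda)$ transmit and $N_r(\lambda)$ receive antennas, SINR and ASE are integrable and 1. the average SINR scales at least like $N_t/\lambda$ and at most like $N_tN_r/\lambda$: $$c\,\frac{N_t(\lambda)}{\lambda}\le\mathbb E[\mathrm{SINR}(\lambda)]\le C\,\frac{N_t(\lambda)N_r(\lambda)}{\lambda};$$ 2. the average ASE scales at least as in the MISO case with $N_t(\lambda)$ antennas and at most as in the MISO case with $N_t(\lambda)N_r(\lambda)$ antennas, both in the sense $$c\,\overline{\mathcal E}_{\rm MISO}(\lambda;N_t(\lambda))\le\mathbb E[\mathcal E(\lambda)]\le C\,\overline{\mathcal E}_{\rm MISO}(\lambda;N_t(\lambda)N_r(\lambda)),$$ where both MISO averages are finite, and, in terms of the explicit MISO scaling function, $$c\,\lambda\log\Bigl(1+\frac{N_t(\lambda)}{\lambda}\Bigr)\le\mathbb E[\mathcal E(\lambda)]\le C\,\lambda\log\Bigl(1+\frac{N_t(\lambda)N_r(\lambda)}{\lambda}\Bigr).$$ -/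

import Mathlib

open MeasureTheory ProbabilityTheory Filter Topology Set
open scoped ENNReal NNReal

universe u v

namespace CellularScaling

/-- A physically feasible large-scale channel gain `L : [0, ∞) → [0, ∞)`
(only the values `L r` with `r ≥ 0` matter):
`L 0` is positive, `L r ≤ L 0`, and `γ = ∫₀^∞ r L(r) dr` is finite and positive. -/
structure PhysicallyFeasible (L : ℝ → ℝ) : Prop where
  measurable : Measurable L
  nonneg : ∀ r, 0 ≤ r → 0 ≤ L r
  zero_pos : 0 < L 0
  le_zero : ∀ r, 0 ≤ r → L r ≤ L 0
  integrableOn : IntegrableOn (fun r => r * L r) (Ioi 0)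
  integral_pos : 0 < ∫ r in Ioi 0, r * L r

/-- The tail assumption on the channel gain: from some radius `r₀` on, `L` dominates a positive,
differentiable, decreasing function `Lt` with `r Lt(r) / (-Lt'(r)) ≥ ζ > 0`
(written without division) and
`∫_{r₀}^∞ r / Lt(r)² exp(-π l r²) dr < ∞` for all `l` beyond some `lc ≥ 0`. -/
def TailAssumption (L : ℝ → ℝ) : Prop :=
  ∃ r₀ : ℝ, 0 ≤ r₀ ∧ ∃ ζ : ℝ, 0 < ζ ∧ ∃ Lt : ℝ → ℝ,
    (∀ r ∈ Ici r₀, 0 < Lt r) ∧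
    DifferentiableOn ℝ Lt (Ici r₀) ∧
    AntitoneOn Lt (Ici r₀) ∧
    (∀ r ∈ Ici r₀, Lt r ≤ L r) ∧
    (∀ r ∈ Ici r₀, ζ * (-derivWithin Lt (Ici r₀) r) ≤ r * Lt r) ∧
    ∃ lc : ℝ, 0 ≤ lc ∧ ∀ l : ℝ, lc < l →
      IntegrableOn (fun r => r / Lt r ^ 2 * Real.exp (-Real.pi * l * r ^ 2)) (Ici r₀)

/-- The law of a circularly symmetric complex Gaussian with mean zero and unit variance:
independent centred real and imaginary parts of variance `1/2`. -/
noncomputable def stdComplexGaussian : Measure ℂ :=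
  ((gaussianReal 0 (1 / 2)).prod (gaussianReal 0 (1 / 2))).map
    (fun p : ℝ × ℝ => (⟨p.1, p.2⟩ : ℂ))

section PointProcess

variable {Ω : Type u} [MeasurableSpace Ω]

/-- The number of points of the sequence `X` that lie in `A`. -/
noncomputable def pointCount (X : ℕ → Ω → EuclideanSpace ℝ (Fin 2))
    (A : Set (EuclideanSpace ℝ (Fin 2))) (ω : Ω) : ℕ∞ :=
  Set.encard {i | X i ω ∈ A}

/-- The points `X 0, X 1, …` form a homogeneous Poisson point process in the plane with
intensity `lam`, and are listed in order of their distance to the origin. -/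
structure IsOrderedHPPP (P : Measure Ω) (lam : ℝ)
    (X : ℕ → Ω → EuclideanSpace ℝ (Fin 2)) : Prop where
  measurable : ∀ i, Measurable (X i)
  count_law : ∀ A : Set (EuclideanSpace ℝ (Fin 2)), MeasurableSet A → volume A ≠ ∞ →
    HasLaw (pointCount X A)
      ((poissonMeasure (ENNReal.ofReal lam * volume A).toNNReal).map
        (fun k : ℕ => (k : ℕ∞))) P
  count_indep : ∀ (n : ℕ) (A : Fin n → Set (EuclideanSpace ℝ (Fin 2))),
    (∀ j, MeasurableSet (A j)) → (∀ j, volume (A j) ≠ ∞) →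
    Pairwise (fun j k => Disjoint (A j) (A k)) →
    iIndepFun (fun j => pointCount X (A j)) P
  ordered : ∀ᵐ ω ∂P, Monotone (fun i => ‖X i ω‖)

end PointProcess

/-- `(w, p)` is a pair of left and right unit singular vectors of `A` for the largest
singular value of `A`. -/
structure IsTopSingularPair {m n : ℕ} (A : Matrix (Fin m) (Fin n) ℂ)
    (w : EuclideanSpace ℂ (Fin m)) (p : EuclideanSpace ℂ (Fin n)) : Prop where
  norm_left : ‖w‖ = 1
  norm_right : ‖p‖ = 1
  map_right : Matrix.toEuclideanLin A p =
    ((Matrix.toEuclideanLin A).singularValues 0 : ℂ) • w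
  map_left : Matrix.toEuclideanLin A.conjTranspose w =
    ((Matrix.toEuclideanLin A).singularValues 0 : ℂ) • p

/-- A downlink network with base-station density `lam`, `Nt` antennas at every base station and
`Nr` antennas at every user, with eigen-beamforming. Base station `i` serves user `i`; user `0` is
at the origin and is served by its closest base station, that is, base station `0`. -/
structure Network (lam : ℝ) (Nt Nr : ℕ) where
  /-- the sample space -/
  Ω : Type u
  [mΩ : MeasurableSpace Ω]
  /-- the probability measure -/
  P : Measure Ω
  [isProb : IsProbabilityMeasure P]
  /-- the positions of the base stations -/
  X : ℕ → Ω → EuclideanSpace ℝ (Fin 2)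
  /-- `H i j` is the channel between base station `i` and user `j` -/
  H : ℕ → ℕ → Ω → Matrix (Fin Nr) (Fin Nt) ℂ
  /-- the combining vector as a function of the channel of the serving link -/
  comb : Matrix (Fin Nr) (Fin Nt) ℂ → EuclideanSpace ℂ (Fin Nr)
  /-- the precoding vector as a function of the channel of the serving link -/
  prec : Matrix (Fin Nr) (Fin Nt) ℂ → EuclideanSpace ℂ (Fin Nt)
  hppp : IsOrderedHPPP P lam X
  measurable_H : ∀ i j a b, Measurable (fun ω => H i j ω a b)
  law_H : ∀ i j a b, HasLaw (fun ω => H i j ω a b) stdComplexGaussian P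
  /-- all the channel coefficients are independent -/
  iIndep_H : iIndepFun
    (fun (k : ℕ × ℕ × Fin Nr × Fin Nt) ω => H k.1 k.2.1 ω k.2.2.1 k.2.2.2) P
  /-- the channels are independent of the positions -/
  indep_X_H : IndepFun (fun ω i => X i ω) (fun ω i j a b => H i j ω a b) P
  measurable_comb : Measurable (fun A : Fin Nr → Fin Nt → ℂ => comb (Matrix.of A))
  measurable_prec : Measurable (fun A : Fin Nr → Fin Nt → ℂ => prec (Matrix.of A))
  eigenBeamforming : ∀ A, IsTopSingularPair A (comb A) (prec A)

attribute [instance] Network.mΩ Network.isProb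

namespace Network

variable {lam : ℝ} {Nt Nr : ℕ}

/-- The channel gain `|w₀* H_{i,0} p_i|²` from base station `i` to user `0`, where `w₀` is the
combining vector of user `0` and `p_i` the precoding vector of base station `i`. -/
noncomputable def gain (N : Network.{u} lam Nt Nr) (i : ℕ) (ω : N.Ω) : ℝ :=
  ‖inner ℂ (N.comb (N.H 0 0 ω))
    (Matrix.toEuclideanLin (N.H i 0 ω) (N.prec (N.H i i ω)))‖ ^ 2

/-- The SINR of user `0`, for the large-scale gain `L` and the noise variance `noiseVar`. -/
noncomputable def sinr (N : Network.{u} lam Nt Nr) (L : ℝ → ℝ) (noiseVar : ℝ) (ω : N.Ω) : ℝ :=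
  L ‖N.X 0 ω‖ * N.gain 0 ω /
    ((∑' i : ℕ, L ‖N.X (i + 1) ω‖ * N.gain (i + 1) ω)
      + ‖N.comb (N.H 0 0 ω)‖ ^ 2 * noiseVar)

/-- The conditional area spectral efficiency. -/
noncomputable def ase (N : Network.{u} lam Nt Nr) (L : ℝ → ℝ) (noiseVar : ℝ) (ω : N.Ω) : ℝ :=
  lam * Real.logb 2 (1 + N.sinr L noiseVar ω)

/-- The average SINR. -/
noncomputable def avgSINR (N : Network.{u} lam Nt Nr) (L : ℝ → ℝ) (noiseVar : ℝ) : ℝ :=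
  ∫ ω, N.sinr L noiseVar ω ∂N.P

/-- The average area spectral efficiency. -/
noncomputable def avgASE (N : Network.{u} lam Nt Nr) (L : ℝ → ℝ) (noiseVar : ℝ) : ℝ :=
  ∫ ω, N.ase L noiseVar ω ∂N.P

end Network

end CellularScaling

/-! Everything reduces to one estimate, `exists_average_bounds`: for all large `lam`, uniformly in
the antenna numbers `Nt, Nr ≥ 1`, the mean SINR lies between multiples of `Nt / lam` and `Nt * Nr /
lam`, and the mean ASE between multiples of `lam * log (1 + ·)` of these two ratios. Uniformity in
the antenna numbers is the point: the estimate also applies to MISO networks, where `Nr = 1` makes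
both ratios coincide, so MISO averages are comparable to the explicit functions.

Upper bound. An interfering link is seen through unit vectors independent of its Gaussian matrix, so
its gain is a unit-mean exponential, and the interfering gains are independent of one another and of
the serving gain (`lintegral_mul_gain`). A sum of `k + 2` of them has inverse moment `1 / (k + 1)`,
and the serving gain has mean at most `Nt * Nr` (Frobenius norm). Given the positions, the mean of
gain over interference is therefore controlled by the number of stations in a region where `L` is
bounded below. A fixed disc holds about `lam` of them, which gives the factor `1 / lam`; the rare
event of a nearly empty disc is handled by growing annuli, where the tail assumption keeps `1 / L`
below a Gaussian growth rate that the Poisson void probabilities beat (`exists_shells`,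
`lintegral_gain_div_interference_le`). Jensen passes from SINR to ASE.

Lower bound. With probability at least `1 / 10` the nearest station is close, the interference is
`O(lam)` (Campbell and Markov) and the serving gain exceeds `Nt / 7` (Chernoff on one row of the
channel matrix); then the SINR is at least a constant times `Nt / lam` (`exists_measure_sinr_ge`).
-/

namespace CellularScaling

/-! ### The standard complex Gaussian: stability, Laplace transform, second moment. -/

lemma measurable_complex_mk : Measurable (fun p : ℝ × ℝ => (⟨p.1, p.2⟩ : ℂ)) :=
  Complex.measurableEquivRealProd.symm.measurable

instance : IsProbabilityMeasure stdComplexGaussian :=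
  Measure.isProbabilityMeasure_map measurable_complex_mk.aemeasurable

lemma charFun_stdComplexGaussian (t : ℂ) :
    charFun stdComplexGaussian t = Complex.exp (-(‖t‖ ^ 2 / 4 : ℝ)) := by
  have h : ∀ p : ℝ × ℝ, Complex.exp ((inner ℝ (⟨p.1, p.2⟩ : ℂ) t : ℝ) * Complex.I)
      = Complex.exp (t.re * p.1 * Complex.I) * Complex.exp (t.im * p.2 * Complex.I) := by
    intro p
    rw [← Complex.exp_add, Complex.inner]
    congr 1
    simp only [Complex.mul_re, Complex.conj_re, Complex.conj_im]
    push_cast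
    ring
  have h2 := integral_prod_mul (μ := gaussianReal 0 (1 / 2)) (ν := gaussianReal 0 (1 / 2))
    (fun x : ℝ => Complex.exp (t.re * x * Complex.I))
    (fun x : ℝ => Complex.exp (t.im * x * Complex.I))
  rw [charFun_apply, stdComplexGaussian,
    integral_map measurable_complex_mk.aemeasurable (by fun_prop)]
  simp only [h]
  rw [h2, ← charFun_apply_real, ← charFun_apply_real, charFun_gaussianReal, charFun_gaussianReal,
    ← Complex.exp_add, Complex.sq_norm, Complex.normSq_apply]
  congr 1
  push_cast
  ring

lemma charFun_stdComplexGaussian_map_mul (c t : ℂ) :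
    charFun (stdComplexGaussian.map (fun z => c * z)) t
      = Complex.exp (-(‖c‖ ^ 2 * ‖t‖ ^ 2 / 4 : ℝ)) := by
  rw [charFun_apply, integral_map (by fun_prop) (by fun_prop)]
  have h : ∀ z : ℂ, inner ℝ (c * z) t = inner ℝ z ((starRingEnd ℂ) c * t) := by
    intro z
    rw [Complex.inner, Complex.inner, map_mul]
    congr 1
    ring
  simp only [h]
  rw [← charFun_apply, charFun_stdComplexGaussian]
  simp [mul_pow]

/-- A linear combination, with square-summing-to-one coefficients, of independent standard complex
Gaussian variables is a standard complex Gaussian variable. -/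
lemma map_sum_mul_stdComplexGaussian {Ω : Type*} [MeasurableSpace Ω] {P : Measure Ω}
    [IsProbabilityMeasure P] {ι : Type*} [Fintype ι] {Z : ι → Ω → ℂ} (hZ : ∀ i, Measurable (Z i))
    (hlaw : ∀ i, P.map (Z i) = stdComplexGaussian) (hind : iIndepFun Z P) (c : ι → ℂ)
    (hc : ∑ i, ‖c i‖ ^ 2 = 1) :
    P.map (fun ω => ∑ i, c i * Z i ω) = stdComplexGaussian := by
  have hm : Measurable (fun ω => ∑ i, c i * Z i ω) := by fun_prop
  have := Measure.isProbabilityMeasure_map (μ := P) hm.aemeasurable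
  refine Measure.ext_of_charFun ?_
  have hind' := hind.comp (fun i z => c i * z) (fun i => by fun_prop)
  rw [show (fun ω => ∑ i, c i * Z i ω) = fun ω => ∑ i, ((fun z => c i * z) ∘ Z i) ω from rfl,
    hind'.charFun_map_fun_sum_eq_prod (fun i => by fun_prop)]
  funext t
  rw [Finset.prod_apply]
  have : ∀ i, charFun (P.map ((fun z => c i * z) ∘ Z i)) t
      = Complex.exp (-(‖c i‖ ^ 2 * ‖t‖ ^ 2 / 4 : ℝ)) := by
    intro i
    rw [← Measure.map_map (by fun_prop) (hZ i), hlaw, charFun_stdComplexGaussian_map_mul]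
  simp only [this]
  rw [← Complex.exp_sum, charFun_stdComplexGaussian]
  congr 1
  rw [Finset.sum_neg_distrib, ← Complex.ofReal_sum, ← Finset.sum_div, ← Finset.sum_mul, hc, one_mul]

lemma lintegral_exp_neg_mul_sq_gaussianReal {t : ℝ} (ht : 0 ≤ t) :
    ∫⁻ x, ENNReal.ofReal (Real.exp (-(t * x ^ 2))) ∂(gaussianReal 0 (1 / 2))
      = ENNReal.ofReal (1 / √(1 + t)) := by
  have hg : ∀ x, gaussianPDFReal 0 (1 / 2) x = (√Real.pi)⁻¹ * Real.exp (-x ^ 2) := by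
    intro x
    simp only [gaussianPDFReal_def]
    congr 2
    · norm_num
      have : √(2 : ℝ) ≠ 0 := by positivity
      field_simp
    · norm_num
  have hf : ∀ x : ℝ, gaussianPDF 0 (1 / 2) x * ENNReal.ofReal (Real.exp (-(t * x ^ 2)))
      = ENNReal.ofReal ((√Real.pi)⁻¹ * Real.exp (-(1 + t) * x ^ 2)) := by
    intro x
    rw [gaussianPDF, hg, ← ENNReal.ofReal_mul (by positivity), mul_assoc, ← Real.exp_add]
    congr 3
    ring
  rw [gaussianReal_of_var_ne_zero _ (by norm_num),
    lintegral_withDensity_eq_lintegral_mul _ (measurable_gaussianPDF _ _) (by fun_prop)]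
  simp only [Pi.mul_apply, hf]
  rw [← ofReal_integral_eq_lintegral_ofReal
    ((integrable_exp_neg_mul_sq (by linarith)).const_mul _)
    (ae_of_all _ fun x => by positivity), integral_const_mul, integral_gaussian]
  congr 1
  rw [Real.sqrt_div' _ (by linarith)]
  have : 0 < √Real.pi := by positivity
  field_simp

lemma lintegral_exp_neg_mul_normSq_stdComplexGaussian {t : ℝ} (ht : 0 ≤ t) :
    ∫⁻ z, ENNReal.ofReal (Real.exp (-(t * ‖z‖ ^ 2))) ∂stdComplexGaussian
      = ENNReal.ofReal (1 / (1 + t)) := by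
  have h : ∀ p : ℝ × ℝ, ENNReal.ofReal (Real.exp (-(t * ‖(⟨p.1, p.2⟩ : ℂ)‖ ^ 2)))
      = ENNReal.ofReal (Real.exp (-(t * p.1 ^ 2))) * ENNReal.ofReal (Real.exp (-(t * p.2 ^ 2))) := by
    intro p
    rw [← ENNReal.ofReal_mul (by positivity), ← Real.exp_add, Complex.sq_norm, Complex.normSq_apply]
    congr 2
    ring
  rw [stdComplexGaussian, lintegral_map (by fun_prop) measurable_complex_mk]
  simp only [h]
  rw [lintegral_prod_mul (f := fun x : ℝ => ENNReal.ofReal (Real.exp (-(t * x ^ 2))))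
    (g := fun x : ℝ => ENNReal.ofReal (Real.exp (-(t * x ^ 2)))) (by fun_prop) (by fun_prop),
    lintegral_exp_neg_mul_sq_gaussianReal ht, ← ENNReal.ofReal_mul (by positivity)]
  congr 1
  rw [div_mul_div_comm, Real.mul_self_sqrt (by linarith), one_mul]

lemma lintegral_sq_gaussianReal :
    ∫⁻ x, ENNReal.ofReal (x ^ 2) ∂(gaussianReal 0 (1 / 2)) = ENNReal.ofReal (1 / 2) := by
  have hL : MemLp (fun x : ℝ => x) 2 (gaussianReal 0 (1 / 2)) := memLp_id_gaussianReal 2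
  rw [← ofReal_integral_eq_lintegral_ofReal hL.integrable_sq (ae_of_all _ fun x => sq_nonneg x)]
  have h := variance_fun_id_gaussianReal (μ := 0) (v := 1 / 2)
  rw [variance_eq_sub hL] at h
  simp only [integral_id_gaussianReal] at h
  congr 1
  simpa using h

lemma lintegral_normSq_stdComplexGaussian :
    ∫⁻ z, ENNReal.ofReal (‖z‖ ^ 2) ∂stdComplexGaussian = 1 := by
  have h : ∀ p : ℝ × ℝ, ENNReal.ofReal (‖(⟨p.1, p.2⟩ : ℂ)‖ ^ 2)
      = ENNReal.ofReal (p.1 ^ 2) * 1 + 1 * ENNReal.ofReal (p.2 ^ 2) := by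
    intro p
    rw [mul_one, one_mul, ← ENNReal.ofReal_add (by positivity) (by positivity), Complex.sq_norm,
      Complex.normSq_apply]
    congr 1
    ring
  rw [stdComplexGaussian, lintegral_map (by fun_prop) measurable_complex_mk]
  simp only [h]
  rw [lintegral_add_left (by fun_prop),
    lintegral_prod_mul (f := fun x : ℝ => ENNReal.ofReal (x ^ 2)) (g := fun _ => 1) (by fun_prop)
      (by fun_prop),
    lintegral_prod_mul (f := fun _ => 1) (g := fun x : ℝ => ENNReal.ofReal (x ^ 2)) (by fun_prop)
      (by fun_prop), lintegral_sq_gaussianReal]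
  simp only [lintegral_const, measure_univ, mul_one, one_mul]
  rw [← ENNReal.ofReal_add (by norm_num) (by norm_num)]
  norm_num

/-! ### Independence tools. -/

/-- Disjoint blocks of an independent family are independent. -/
lemma indepFun_of_disjoint_blocks {Ω ι β γ δ : Type*} [MeasurableSpace Ω] [MeasurableSpace β]
    [MeasurableSpace γ] [MeasurableSpace δ] {P : Measure Ω} {f : ι → Ω → β}
    (hf : ∀ i, Measurable (f i)) (hind : iIndepFun f P) {S T : Set ι} (hST : Disjoint S T)
    {G : Ω → γ} {W : Ω → δ}
    (hG : Measurable[⨆ i ∈ S, MeasurableSpace.comap (f i) inferInstance] G)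
    (hW : Measurable[⨆ i ∈ T, MeasurableSpace.comap (f i) inferInstance] W) :
    IndepFun G W P := by
  have h := indep_iSup_of_disjoint (fun i => (hf i).comap_le) hind hST
  rw [IndepFun_iff_Indep]
  exact indep_of_indep_of_le_left (indep_of_indep_of_le_right h hW.comap_le) hG.comap_le

/-- Fubini on the product law. It serves as conditioning: `G` is frozen in the outer integral while
`W` is averaged in the inner one. -/
lemma lintegral_of_indepFun {Ω γ δ : Type*} [MeasurableSpace Ω] [MeasurableSpace γ]
    [MeasurableSpace δ] {P : Measure Ω} [IsProbabilityMeasure P] {G : Ω → γ} {W : Ω → δ}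
    (hG : Measurable G) (hW : Measurable W) (hind : IndepFun G W P) {F : γ × δ → ℝ≥0∞}
    (hF : Measurable F) :
    ∫⁻ ω, F (G ω, W ω) ∂P = ∫⁻ ω, ∫⁻ ω', F (G ω, W ω') ∂P ∂P := by
  have h := (indepFun_iff_map_prod_eq_prod_map_map hG.aemeasurable hW.aemeasurable).1 hind
  have := Measure.isProbabilityMeasure_map (μ := P) hW.aemeasurable
  rw [← lintegral_map hF (hG.prodMk hW), h, lintegral_prod _ hF.aemeasurable,
    lintegral_map hF.lintegral_prod_right' hG]
  refine lintegral_congr fun ω => ?_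
  exact lintegral_map (hF.comp measurable_prodMk_left) hW

/-! ### Bounds on the top singular value of a matrix. -/

section SingularValues

variable {m n : ℕ} {A : Matrix (Fin m) (Fin n) ℂ}

/-- Expand `x` in an eigenbasis of `T* T`: the squared norm of the image is a combination of
eigenvalues with weights summing to `‖x‖ ^ 2`, and the eigenvalue of index `0` is the largest. -/
lemma norm_toEuclideanLin_sq_le (x : EuclideanSpace ℂ (Fin n)) :
    ‖Matrix.toEuclideanLin A x‖ ^ 2
      ≤ (Matrix.toEuclideanLin A).singularValues 0 ^ 2 * ‖x‖ ^ 2 := by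
  set T := Matrix.toEuclideanLin A
  rcases Nat.eq_zero_or_pos n with hn | hn
  · subst hn
    rw [Subsingleton.elim x 0]
    simp
  have hfr : Module.finrank ℂ (EuclideanSpace ℂ (Fin n)) = n := by simp
  have hS := T.isSymmetric_adjoint_comp_self
  rw [T.sq_singularValues_of_lt hfr hn]
  set b := hS.eigenvectorBasis hfr
  have h1 : (‖T x‖ ^ 2 : ℝ) = RCLike.re (inner ℂ ((LinearMap.adjoint T ∘ₗ T) x) x) := by
    rw [LinearMap.comp_apply, LinearMap.adjoint_inner_left, inner_self_eq_norm_sq]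
  have h2 : inner ℂ ((LinearMap.adjoint T ∘ₗ T) x) x
      = ∑ i, ((hS.eigenvalues hfr i * ‖inner ℂ (b i) x‖ ^ 2 : ℝ) : ℂ) := by
    rw [← b.sum_inner_mul_inner]
    refine Finset.sum_congr rfl fun i _ => ?_
    rw [hS x (b i), hS.apply_eigenvectorBasis hfr i, inner_smul_right, mul_assoc,
      ← inner_conj_symm x]
    change _ * (starRingEnd ℂ (inner ℂ (b i) x) * inner ℂ (b i) x) = _
    rw [Complex.conj_mul']
    push_cast
    rfl
  rw [h1, h2, ← b.sum_sq_norm_inner_right x, Finset.mul_sum]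
  simp only [← Complex.ofReal_sum]
  rw [RCLike.re_eq_complex_re, Complex.ofReal_re]
  refine Finset.sum_le_sum fun i _ => ?_
  refine mul_le_mul_of_nonneg_right (hS.eigenvalues_antitone hfr ?_) (sq_nonneg _)
  exact Nat.zero_le _

variable {w : EuclideanSpace ℂ (Fin m)} {p : EuclideanSpace ℂ (Fin n)}

lemma IsTopSingularPair.norm_inner_sq (h : IsTopSingularPair A w p) :
    ‖inner ℂ w (Matrix.toEuclideanLin A p)‖ ^ 2
      = (Matrix.toEuclideanLin A).singularValues 0 ^ 2 := by
  rw [h.map_right, inner_smul_right, inner_self_eq_norm_sq_to_K, h.norm_left]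
  simp

lemma inner_toEuclideanLin (w : EuclideanSpace ℂ (Fin m)) (p : EuclideanSpace ℂ (Fin n)) :
    inner ℂ w (Matrix.toEuclideanLin A p)
      = ∑ k : Fin m × Fin n, (starRingEnd ℂ (w k.1) * p k.2) * A k.1 k.2 := by
  rw [Fintype.sum_prod_type, PiLp.inner_apply]
  refine Finset.sum_congr rfl fun a _ => ?_
  simp only [Matrix.toLpLin_apply, Matrix.mulVec, dotProduct, RCLike.inner_apply,
    Finset.sum_mul]
  exact Finset.sum_congr rfl fun b _ => by ring

lemma sum_norm_sq_outer (hw : ‖w‖ = 1) (hp : ‖p‖ = 1) :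
    ∑ k : Fin m × Fin n, ‖starRingEnd ℂ (w k.1) * p k.2‖ ^ 2 = 1 := by
  rw [Fintype.sum_prod_type]
  simp only [norm_mul, mul_pow, RCLike.norm_conj, ← Finset.mul_sum, ← Finset.sum_mul,
    ← EuclideanSpace.norm_sq_eq, hw, hp]
  norm_num

/-- Cauchy–Schwarz: the coefficients of the bilinear form are the entries of a rank-one matrix of
unit Frobenius norm. -/
lemma norm_inner_sq_le_frobenius (hw : ‖w‖ = 1) (hp : ‖p‖ = 1) :
    ‖inner ℂ w (Matrix.toEuclideanLin A p)‖ ^ 2 ≤ ∑ k : Fin m × Fin n, ‖A k.1 k.2‖ ^ 2 := by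
  rw [inner_toEuclideanLin]
  calc _ ≤ (∑ k : Fin m × Fin n, ‖starRingEnd ℂ (w k.1) * p k.2‖ * ‖A k.1 k.2‖) ^ 2 := by
        gcongr
        exact (norm_sum_le _ _).trans_eq (by simp only [norm_mul])
    _ ≤ _ := Finset.sum_mul_sq_le_sq_mul_sq _ _ _
    _ = _ := by rw [sum_norm_sq_outer hw hp, one_mul]

/-- Test the operator bound on the conjugated row `a`: its squared norm is `S` and coordinate `a` of
its image is `S`, so `S ^ 2 ≤ σ ^ 2 * S`. This gives the lower bound on the serving gain by a sum of
independent terms. -/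
lemma IsTopSingularPair.row_le (h : IsTopSingularPair A w p) (a : Fin m) :
    ∑ b, ‖A a b‖ ^ 2 ≤ ‖inner ℂ w (Matrix.toEuclideanLin A p)‖ ^ 2 := by
  rw [h.norm_inner_sq]
  set S := ∑ b, ‖A a b‖ ^ 2
  have hS : 0 ≤ S := Finset.sum_nonneg fun b _ => sq_nonneg _
  let x : EuclideanSpace ℂ (Fin n) := WithLp.toLp 2 fun b => starRingEnd ℂ (A a b)
  have hx : ‖x‖ ^ 2 = S := by simp [x, S, EuclideanSpace.norm_sq_eq]
  have hT : Matrix.toEuclideanLin A x a = (S : ℂ) := by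
    simp [x, S, Matrix.toLpLin_apply, Matrix.mulVec, dotProduct, Complex.mul_conj,
      Complex.normSq_eq_norm_sq]
  have h1 := norm_toEuclideanLin_sq_le (A := A) x
  have h2 : S ^ 2 ≤ ‖Matrix.toEuclideanLin A x‖ ^ 2 := by
    have := PiLp.norm_apply_le (Matrix.toEuclideanLin A x) a
    rw [hT, Complex.norm_real, Real.norm_of_nonneg hS] at this
    gcongr
  rw [hx] at h1
  rcases hS.eq_or_lt with h0 | h0
  · rw [← h0]
    positivity
  · nlinarith

end SingularValues

/-! ### Joint law of the channel gains. -/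

namespace Network

variable {lam : ℝ} {Nt Nr : ℕ} (N : Network.{u} lam Nt Nr)

/-- All the channel coefficients, as one random element. -/
def channels (ω : N.Ω) : ℕ → ℕ → Fin Nr → Fin Nt → ℂ := fun i j a b => N.H i j ω a b

/-- The channel gain as a function of the channel coefficients. -/
noncomputable def gainOf (h : ℕ → ℕ → Fin Nr → Fin Nt → ℂ) (i : ℕ) : ℝ :=
  ‖inner ℂ (N.comb (Matrix.of (h 0 0)))
    (Matrix.toEuclideanLin (Matrix.of (h i 0)) (N.prec (Matrix.of (h i i))))‖ ^ 2

lemma gain_eq_gainOf (i : ℕ) (ω : N.Ω) : N.gain i ω = N.gainOf (N.channels ω) i := rfl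

lemma measurable_channels : Measurable N.channels := by
  refine measurable_pi_lambda _ fun i => measurable_pi_lambda _ fun j =>
    measurable_pi_lambda _ fun a => measurable_pi_lambda _ fun b => N.measurable_H i j a b

lemma measurable_channels_apply (i j : ℕ) : Measurable fun ω => N.channels ω i j :=
  measurable_pi_lambda _ fun a => measurable_pi_lambda _ fun b => N.measurable_H i j a b

lemma measurable_eval (i j : ℕ) :
    Measurable fun h : ℕ → ℕ → Fin Nr → Fin Nt → ℂ => h i j :=
  (measurable_pi_apply j).comp (measurable_pi_apply i)

lemma measurable_norm_inner_sq {α : Type*} [MeasurableSpace α] {A B C : α → Fin Nr → Fin Nt → ℂ}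
    (hA : Measurable A) (hB : Measurable B) (hC : Measurable C) :
    Measurable fun x => ‖inner ℂ (N.comb (Matrix.of (A x)))
      (Matrix.toEuclideanLin (Matrix.of (B x)) (N.prec (Matrix.of (C x))))‖ ^ 2 := by
  simp only [inner_toEuclideanLin]
  have h1 := N.measurable_comb.comp hA
  have h2 := N.measurable_prec.comp hC
  have h3 : ∀ a, Measurable fun x => (N.comb (Matrix.of (A x))) a := fun a =>
    ((measurable_pi_apply a).comp (WithLp.measurable_ofLp 2 _)).comp h1
  have h4 : ∀ b, Measurable fun x => (N.prec (Matrix.of (C x))) b := fun b =>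
    ((measurable_pi_apply b).comp (WithLp.measurable_ofLp 2 _)).comp h2
  have h5 : ∀ a b, Measurable fun x => (Matrix.of (B x)) a b := fun a b =>
    (measurable_pi_apply b).comp ((measurable_pi_apply a).comp hB)
  refine Measurable.pow_const (Measurable.norm (Finset.measurable_sum _ fun k _ => ?_)) 2
  refine Measurable.mul (Measurable.mul ?_ (h4 _)) (h5 _ _)
  exact Complex.continuous_conj.measurable.comp (h3 _)

lemma measurable_gainOf (i : ℕ) : Measurable fun h => N.gainOf h i :=
  N.measurable_norm_inner_sq (measurable_eval 0 0) (measurable_eval i 0) (measurable_eval i i)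

lemma measurable_gain (i : ℕ) : Measurable (N.gain i) := by
  have h : N.gain i = (fun h => N.gainOf h i) ∘ N.channels :=
    funext fun ω => N.gain_eq_gainOf i ω
  rw [h]
  exact (N.measurable_gainOf i).comp N.measurable_channels

lemma gain_nonneg (i : ℕ) (ω : N.Ω) : 0 ≤ N.gain i ω := sq_nonneg _

/-- The channel coefficients with those between base station `i` and user `0` deleted. -/
def mask (i : ℕ) (h : ℕ → ℕ → Fin Nr → Fin Nt → ℂ) : ℕ → ℕ → Fin Nr → Fin Nt → ℂ :=
  fun j k a b => if j = i ∧ k = 0 then 0 else h j k a b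

lemma measurable_mask (i : ℕ) : Measurable (mask (Nt := Nt) (Nr := Nr) i) := by
  refine measurable_pi_lambda _ fun j => measurable_pi_lambda _ fun k =>
    measurable_pi_lambda _ fun a => measurable_pi_lambda _ fun b => ?_
  unfold mask
  split_ifs <;> fun_prop

/-- The gain of link `j` uses only the blocks `(0, 0)`, `(j, 0)` and `(j, j)`, none of which is the
deleted block `(i, 0)`. -/
lemma gainOf_mask {i j : ℕ} (hi : i ≠ 0) (hj : j ≠ i) (h : ℕ → ℕ → Fin Nr → Fin Nt → ℂ) :
    N.gainOf (mask i h) j = N.gainOf h j := by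
  have h1 : mask i h 0 0 = h 0 0 := by funext a b; simp [mask, hi.symm]
  have h2 : mask i h j 0 = h j 0 := by funext a b; simp [mask, hj]
  have h3 : mask i h j j = h j j := by funext a b; simp [mask, hj]
  rw [gainOf, h1, h2, h3, gainOf]

lemma indepFun_mask_channels (i : ℕ) :
    IndepFun (fun ω => mask i (N.channels ω)) (fun ω => N.channels ω i 0) N.P := by
  refine indepFun_of_disjoint_blocks
    (fun k : ℕ × ℕ × Fin Nr × Fin Nt => N.measurable_H k.1 k.2.1 k.2.2.1 k.2.2.2) N.iIndep_H
    (S := {k | ¬ (k.1 = i ∧ k.2.1 = 0)}) (T := {k | k.1 = i ∧ k.2.1 = 0})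
    (Set.disjoint_left.2 fun k h1 h2 => h1 h2) ?_ ?_
  · refine @measurable_pi_lambda _ _ _ (_) _ _ fun j => @measurable_pi_lambda _ _ _ (_) _ _ fun k =>
      @measurable_pi_lambda _ _ _ (_) _ _ fun a => @measurable_pi_lambda _ _ _ (_) _ _ fun b => ?_
    by_cases hjk : j = i ∧ k = 0
    · simp only [mask, hjk, and_self, if_true]
      exact @measurable_const _ _ _ (_) _
    · simp only [mask, hjk, if_false]
      refine Measurable.mono (comap_measurable (N.H j k · a b)) ?_ le_rfl
      exact le_iSup₂_of_le (j, k, a, b) hjk le_rfl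
  · refine @measurable_pi_lambda _ _ _ (_) _ _ fun a => @measurable_pi_lambda _ _ _ (_) _ _ fun b => ?_
    refine Measurable.mono (comap_measurable (N.H i 0 · a b)) ?_ le_rfl
    exact le_iSup₂_of_le (i, 0, a, b) ⟨rfl, rfl⟩ le_rfl

lemma norm_comb (A : Matrix (Fin Nr) (Fin Nt) ℂ) : ‖N.comb A‖ = 1 :=
  (N.eigenBeamforming A).norm_left

lemma norm_prec (A : Matrix (Fin Nr) (Fin Nt) ℂ) : ‖N.prec A‖ = 1 :=
  (N.eigenBeamforming A).norm_right

/-- For fixed unit vectors the bilinear form is a combination of i.i.d. Gaussians whose coefficients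
have square sum one, so its law depends on neither vector. This is what decouples an interfering
gain from the beamformers. -/
lemma lintegral_quadratic_form (i j : ℕ) {w : EuclideanSpace ℂ (Fin Nr)}
    {p : EuclideanSpace ℂ (Fin Nt)} (hw : ‖w‖ = 1) (hp : ‖p‖ = 1) {f : ℝ → ℝ≥0∞}
    (hf : Measurable f) :
    ∫⁻ ω, f (‖inner ℂ w (Matrix.toEuclideanLin (N.H i j ω) p)‖ ^ 2) ∂N.P
      = ∫⁻ z, f (‖z‖ ^ 2) ∂stdComplexGaussian := by
  simp only [inner_toEuclideanLin]
  have hinj : Function.Injective (fun k : Fin Nr × Fin Nt => ((i, j, k.1, k.2) : ℕ × ℕ × _ × _)) := by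
    rintro ⟨a, b⟩ ⟨c, d⟩ h
    simpa using h
  have h := map_sum_mul_stdComplexGaussian (P := N.P)
    (Z := fun (k : Fin Nr × Fin Nt) ω => N.H i j ω k.1 k.2)
    (fun k => N.measurable_H i j k.1 k.2) (fun k => (N.law_H i j k.1 k.2).map_eq)
    (N.iIndep_H.precomp hinj) _ (sum_norm_sq_outer hw hp)
  rw [← h, lintegral_map (by fun_prop)]
  exact Finset.measurable_sum _ fun k _ => (N.measurable_H i j k.1 k.2).const_mul _

/-- The gain of an interfering link is the squared modulus of a standard complex Gaussian,
independent of everything that does not depend on the channel of this link. -/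
lemma lintegral_mul_gain {i : ℕ} (hi : i ≠ 0) {Z : (ℕ → ℕ → Fin Nr → Fin Nt → ℂ) → ℝ≥0∞}
    (hZm : Measurable Z) (hZ : ∀ h, Z (mask i h) = Z h) {f : ℝ → ℝ≥0∞} (hf : Measurable f) :
    ∫⁻ ω, Z (N.channels ω) * f (N.gain i ω) ∂N.P
      = (∫⁻ ω, Z (N.channels ω) ∂N.P) * ∫⁻ z, f (‖z‖ ^ 2) ∂stdComplexGaussian := by
  have h00 : ∀ h : ℕ → ℕ → Fin Nr → Fin Nt → ℂ, mask i h 0 0 = h 0 0 := fun h => by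
    funext a b; simp [mask, hi.symm]
  have hii : ∀ h : ℕ → ℕ → Fin Nr → Fin Nt → ℂ, mask i h i i = h i i := fun h => by
    funext a b; simp [mask, hi]
  -- Both beamformers survive the masking, so the integrand is a function of the masked channels and
  -- of the independent block `(i, 0)`.
  let F : (ℕ → ℕ → Fin Nr → Fin Nt → ℂ) × (Fin Nr → Fin Nt → ℂ) → ℝ≥0∞ := fun q =>
    Z q.1 * f (‖inner ℂ (N.comb (Matrix.of (q.1 0 0)))
      (Matrix.toEuclideanLin (Matrix.of q.2) (N.prec (Matrix.of (q.1 i i))))‖ ^ 2)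
  have hF : Measurable F := (hZm.comp measurable_fst).mul
    (hf.comp (N.measurable_norm_inner_sq ((measurable_eval 0 0).comp measurable_fst) measurable_snd
      ((measurable_eval i i).comp measurable_fst)))
  have key := lintegral_of_indepFun ((measurable_mask i).comp N.measurable_channels)
    (W := fun ω => N.channels ω i 0)
    (N.measurable_channels_apply i 0)
    (N.indepFun_mask_channels i) hF
  have e1 : ∀ ω, F ((mask i ∘ N.channels) ω, N.channels ω i 0)
      = Z (N.channels ω) * f (N.gain i ω) := by
    intro ω
    simp only [F, Function.comp_apply, h00, hii, hZ]
    rfl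
  simp only [e1] at key
  rw [key, ← lintegral_mul_const (r := ∫⁻ z, f (‖z‖ ^ 2) ∂stdComplexGaussian)
    (f := fun ω => Z (N.channels ω)) (hf := hZm.comp N.measurable_channels)]
  refine lintegral_congr fun ω => ?_
  simp only [F, Function.comp_apply, h00, hii, hZ]
  rw [lintegral_const_mul]
  · rw [← N.lintegral_quadratic_form i 0 (N.norm_comb (N.H 0 0 ω)) (N.norm_prec (N.H i i ω)) hf]
    rfl
  · refine hf.comp (N.measurable_norm_inner_sq measurable_const
      (N.measurable_channels_apply i 0) measurable_const)

lemma lintegral_gain {i : ℕ} (hi : i ≠ 0) : ∫⁻ ω, ENNReal.ofReal (N.gain i ω) ∂N.P = 1 := by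
  have h := N.lintegral_mul_gain hi (Z := fun _ => 1) measurable_const (fun _ => rfl)
    ENNReal.measurable_ofReal
  simpa only [one_mul, lintegral_normSq_stdComplexGaussian, lintegral_const, measure_univ,
    mul_one] using h

/-- Induction peeling off one interfering link at a time: the remaining product does not involve the
block of the link removed. -/
lemma lintegral_gain_zero_mul_prod (S : Finset ℕ) {f : ℝ → ℝ≥0∞} (hf : Measurable f) :
    ∫⁻ ω, ENNReal.ofReal (N.gain 0 ω) * ∏ i ∈ S, f (N.gain (i + 1) ω) ∂N.P
      = (∫⁻ ω, ENNReal.ofReal (N.gain 0 ω) ∂N.P)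
        * (∫⁻ z, f (‖z‖ ^ 2) ∂stdComplexGaussian) ^ S.card := by
  induction S using Finset.cons_induction with
  | empty => simp
  | cons j S hj ih =>
    have h := N.lintegral_mul_gain (i := j + 1) (by omega)
      (Z := fun h => ENNReal.ofReal (N.gainOf h 0) * ∏ i ∈ S, f (N.gainOf h (i + 1)))
      ((N.measurable_gainOf 0).ennreal_ofReal.mul
        (Finset.measurable_prod _ fun i _ => hf.comp (N.measurable_gainOf _))) ?_ hf
    · rw [Finset.card_cons, pow_succ, ← mul_assoc, ← ih]
      simp only [← gain_eq_gainOf] at h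
      rw [← h]
      refine lintegral_congr fun ω => ?_
      rw [Finset.prod_cons]
      ring
    · intro h
      rw [N.gainOf_mask (by omega) (by omega)]
      congr 1
      refine Finset.prod_congr rfl fun i hi => ?_
      rw [N.gainOf_mask (by omega) fun h => hj (by rwa [← Nat.succ_injective h])]

end Network

/-! ### Inverse moments of sums of gains, and size of the serving gain. -/

lemma lintegral_Ioi_exp_neg_mul {s : ℝ} (hs : 0 ≤ s) :
    ∫⁻ t in Ioi (0 : ℝ), ENNReal.ofReal (Real.exp (-(t * s))) = (ENNReal.ofReal s)⁻¹ := by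
  rcases hs.eq_or_lt with rfl | hs
  · simp
  · have h : ∀ t : ℝ, Real.exp (-(t * s)) = Real.exp (-s * t) := fun t => by ring_nf
    simp only [h]
    rw [← ofReal_integral_eq_lintegral_ofReal (integrableOn_exp_mul_Ioi (by linarith) 0)
      (ae_of_all _ fun t => by positivity), integral_exp_mul_Ioi (by linarith),
      ← ENNReal.ofReal_inv_of_pos hs]
    congr 1
    simp

/-- The integrand is a power of the Laplace transform of a unit exponential, so this is the inverse
moment of a sum of `k + 2` independent ones. The exponent must be at least `2`: for a single
exponential the integral diverges. -/
lemma lintegral_Ioi_one_div_pow (k : ℕ) :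
    ∫⁻ t in Ioi (0 : ℝ), ENNReal.ofReal (1 / (1 + t)) ^ (k + 2) = ((k + 1 : ℕ) : ℝ≥0∞)⁻¹ := by
  have hd : ∀ t ∈ Ici (0 : ℝ), HasDerivAt (fun t : ℝ => -((k + 1 : ℝ)⁻¹ * ((1 + t) ^ (k + 1))⁻¹))
      ((1 / (1 + t)) ^ (k + 2)) t := by
    intro t ht
    have ht : 0 < 1 + t := by linarith [mem_Ici.1 ht]
    have h1 : HasDerivAt (fun t : ℝ => (1 + t) ^ (k + 1)) ((k + 1 : ℕ) * (1 + t) ^ k * 1) t := by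
      exact ((hasDerivAt_id t).const_add 1).pow (k + 1)
    have h2 := ((h1.inv (by positivity)).const_mul (k + 1 : ℝ)⁻¹).neg
    refine h2.congr_deriv ?_
    push_cast
    rw [one_div_pow]
    field_simp
    ring
  have hlim : Tendsto (fun t : ℝ => -((k + 1 : ℝ)⁻¹ * ((1 + t) ^ (k + 1))⁻¹)) atTop (𝓝 0) := by
    have h1 : Tendsto (fun t : ℝ => (1 + t) ^ (k + 1)) atTop atTop :=
      (tendsto_pow_atTop (by omega)).comp (tendsto_atTop_add_const_left _ 1 tendsto_id)
    simpa using (h1.inv_tendsto_atTop.const_mul (k + 1 : ℝ)⁻¹).neg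
  have hpos : ∀ t ∈ Ioi (0 : ℝ), 0 ≤ (1 / (1 + t)) ^ (k + 2) := by
    intro t ht
    have : 0 < 1 + t := by linarith [mem_Ioi.1 ht]
    positivity
  have hint := integrableOn_Ioi_deriv_of_nonneg' hd hpos hlim
  have heq := integral_Ioi_of_hasDerivAt_of_nonneg' hd hpos hlim
  rw [setLIntegral_congr_fun (g := fun t => ENNReal.ofReal ((1 / (1 + t)) ^ (k + 2)))
    measurableSet_Ioi fun t ht => ?_,
    ← ofReal_integral_eq_lintegral_ofReal hint (ae_restrict_of_forall_mem measurableSet_Ioi hpos),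
    heq, ← ENNReal.ofReal_natCast, ← ENNReal.ofReal_inv_of_pos (by positivity)]
  · congr 1
    push_cast
    simp
  · have : 0 < 1 + t := by linarith [mem_Ioi.1 ht]
    exact (ENNReal.ofReal_pow (by positivity) _).symm

namespace Network

variable {lam : ℝ} {Nt Nr : ℕ} (N : Network.{u} lam Nt Nr)

/-- The inverse moment of a sum of at least two interfering gains. -/
lemma lintegral_gain_zero_div_sum (S : Finset ℕ) {k : ℕ} (hS : S.card = k + 2) :
    ∫⁻ ω, ENNReal.ofReal (N.gain 0 ω) * (ENNReal.ofReal (∑ i ∈ S, N.gain (i + 1) ω))⁻¹ ∂N.P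
      = (∫⁻ ω, ENNReal.ofReal (N.gain 0 ω) ∂N.P) * ((k + 1 : ℕ) : ℝ≥0∞)⁻¹ := by
  -- Writing `1 / s` as the integral of `exp (-t s)` turns the inverse of a sum into a product over
  -- links, which factorizes under the expectation.
  have h1 : ∀ ω, (ENNReal.ofReal (∑ i ∈ S, N.gain (i + 1) ω))⁻¹
      = ∫⁻ t in Ioi (0 : ℝ), ∏ i ∈ S, ENNReal.ofReal (Real.exp (-(t * N.gain (i + 1) ω))) := by
    intro ω
    rw [← lintegral_Ioi_exp_neg_mul (Finset.sum_nonneg fun i _ => N.gain_nonneg _ ω)]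
    refine lintegral_congr fun t => ?_
    rw [← ENNReal.ofReal_prod_of_nonneg fun i _ => by positivity, ← Real.exp_sum,
      Finset.sum_neg_distrib, Finset.mul_sum]
  have hm : Measurable fun q : N.Ω × ℝ =>
      ∏ i ∈ S, ENNReal.ofReal (Real.exp (-(q.2 * N.gain (i + 1) q.1))) := by
    refine Finset.measurable_prod _ fun i _ => ?_
    have := N.measurable_gain (i + 1)
    fun_prop
  have hg := (N.measurable_gain 0).ennreal_ofReal
  calc _ = ∫⁻ ω, (∫⁻ t in Ioi (0 : ℝ), ENNReal.ofReal (N.gain 0 ω) *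
        ∏ i ∈ S, ENNReal.ofReal (Real.exp (-(t * N.gain (i + 1) ω)))) ∂N.P := by
        refine lintegral_congr fun ω => ?_
        rw [h1, lintegral_const_mul]
        exact hm.comp measurable_prodMk_left
    _ = ∫⁻ t in Ioi (0 : ℝ), ∫⁻ ω, ENNReal.ofReal (N.gain 0 ω) *
        ∏ i ∈ S, ENNReal.ofReal (Real.exp (-(t * N.gain (i + 1) ω))) ∂N.P :=
        lintegral_lintegral_swap (((hg.comp measurable_fst).mul hm).aemeasurable)
    _ = ∫⁻ t in Ioi (0 : ℝ), (∫⁻ ω, ENNReal.ofReal (N.gain 0 ω) ∂N.P)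
        * ENNReal.ofReal (1 / (1 + t)) ^ (k + 2) := by
        refine setLIntegral_congr_fun measurableSet_Ioi fun t ht => ?_
        have h := N.lintegral_gain_zero_mul_prod S
          (f := fun x => ENNReal.ofReal (Real.exp (-(t * x)))) (by fun_prop)
        rw [lintegral_exp_neg_mul_normSq_stdComplexGaussian (le_of_lt ht), hS] at h
        exact h
    _ = _ := by rw [lintegral_const_mul _ (by fun_prop), lintegral_Ioi_one_div_pow]

lemma gain_zero_le (ω : N.Ω) :
    N.gain 0 ω ≤ ∑ k : Fin Nr × Fin Nt, ‖N.H 0 0 ω k.1 k.2‖ ^ 2 :=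
  norm_inner_sq_le_frobenius (N.norm_comb _) (N.norm_prec _)

lemma row_le_gain_zero (a : Fin Nr) (ω : N.Ω) :
    ∑ b, ‖N.H 0 0 ω a b‖ ^ 2 ≤ N.gain 0 ω :=
  (N.eigenBeamforming (N.H 0 0 ω)).row_le a

lemma lintegral_coeff (i j : ℕ) (a : Fin Nr) (b : Fin Nt) {f : ℝ → ℝ≥0∞} (hf : Measurable f) :
    ∫⁻ ω, f (‖N.H i j ω a b‖ ^ 2) ∂N.P = ∫⁻ z, f (‖z‖ ^ 2) ∂stdComplexGaussian :=
  (N.law_H i j a b).lintegral_comp (f := fun z => f (‖z‖ ^ 2)) (by fun_prop)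

lemma lintegral_gain_zero_le :
    ∫⁻ ω, ENNReal.ofReal (N.gain 0 ω) ∂N.P ≤ (Nt : ℝ≥0∞) * Nr := by
  calc _ ≤ ∫⁻ ω, ∑ k : Fin Nr × Fin Nt, ENNReal.ofReal (‖N.H 0 0 ω k.1 k.2‖ ^ 2) ∂N.P := by
        refine lintegral_mono fun ω => ?_
        rw [← ENNReal.ofReal_sum_of_nonneg fun k _ => by positivity]
        exact ENNReal.ofReal_le_ofReal (N.gain_zero_le ω)
    _ = ∑ k : Fin Nr × Fin Nt, 1 := by
        rw [lintegral_finsetSum]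
        · refine Finset.sum_congr rfl fun k _ => ?_
          rw [N.lintegral_coeff 0 0 k.1 k.2 ENNReal.measurable_ofReal,
            lintegral_normSq_stdComplexGaussian]
        · intro k _
          have := N.measurable_H 0 0 k.1 k.2
          fun_prop
    _ = _ := by simp [mul_comm]

/-- The gain of the serving link is at least a constant times `Nt` with large probability. -/
lemma measure_gain_zero_le (hNt : 1 ≤ Nt) (hNr : 1 ≤ Nr) :
    N.P {ω | N.gain 0 ω ≤ Nt / 7} ≤ ENNReal.ofReal (Real.exp 1 / 8) := by
  let a : Fin Nr := ⟨0, hNr⟩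
  -- Chernoff bound on one row at Laplace parameter `7`: the transform `1 / (1 + 7)` per entry
  -- against the threshold `exp (-Nt)` gives `(e / 8) ^ Nt`, at most `e / 8` because `Nt ≥ 1`.
  have hrow : ∫⁻ ω, ∏ b : Fin Nt, ENNReal.ofReal (Real.exp (-(7 * ‖N.H 0 0 ω a b‖ ^ 2))) ∂N.P
      = ENNReal.ofReal ((1 / 8) ^ Nt) := by
    have hinj : Function.Injective (fun b : Fin Nt => ((0, 0, a, b) : ℕ × ℕ × _ × _)) := by
      intro b c h
      simpa using h
    have hind := (N.iIndep_H.precomp hinj).comp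
      (fun _ z => ENNReal.ofReal (Real.exp (-(7 * ‖z‖ ^ 2)))) (fun _ => by fun_prop)
    have h := lintegral_prod_eq_prod_lintegral_of_indepFun Finset.univ _ hind
      (fun b => Measurable.comp (by fun_prop) (N.measurable_H 0 0 a b))
    simp only [Function.comp_apply] at h
    rw [h, ENNReal.ofReal_pow (by norm_num)]
    have h2 : ∀ b : Fin Nt, ∫⁻ ω, ENNReal.ofReal (Real.exp (-(7 * ‖N.H 0 0 ω a b‖ ^ 2))) ∂N.P
        = ENNReal.ofReal (1 / 8) := by
      intro b
      rw [N.lintegral_coeff 0 0 a b (f := fun x => ENNReal.ofReal (Real.exp (-(7 * x))))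
        (by fun_prop), lintegral_exp_neg_mul_normSq_stdComplexGaussian (by norm_num)]
      norm_num
    rw [Finset.prod_congr rfl fun b _ => h2 b]
    simp
  have hsub : {ω | N.gain 0 ω ≤ Nt / 7} ⊆ {ω | ENNReal.ofReal (Real.exp (-Nt)) ≤
      ∏ b : Fin Nt, ENNReal.ofReal (Real.exp (-(7 * ‖N.H 0 0 ω a b‖ ^ 2)))} := by
    intro ω hω
    rw [mem_ofPred_eq] at hω ⊢
    rw [← ENNReal.ofReal_prod_of_nonneg fun i _ => by positivity, ← Real.exp_sum,
      Finset.sum_neg_distrib, ← Finset.mul_sum]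
    refine ENNReal.ofReal_le_ofReal (Real.exp_le_exp.2 ?_)
    have := N.row_le_gain_zero a ω
    linarith
  have hm : Measurable fun ω =>
      ∏ b : Fin Nt, ENNReal.ofReal (Real.exp (-(7 * ‖N.H 0 0 ω a b‖ ^ 2))) := by
    refine Finset.measurable_prod _ fun b _ => ?_
    have := N.measurable_H 0 0 a b
    fun_prop
  calc _ ≤ _ := measure_mono hsub
    _ ≤ _ := meas_ge_le_lintegral_div hm.aemeasurable
      (by simp [Real.exp_pos]) ENNReal.ofReal_ne_top
    _ = ENNReal.ofReal ((Real.exp 1 / 8) ^ Nt) := by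
      rw [hrow, ← ENNReal.ofReal_div_of_pos (Real.exp_pos _), Real.exp_neg, div_pow,
        div_pow, ← Real.exp_nat_mul, mul_one]
      congr 1
      rw [one_pow]
      field_simp
    _ ≤ _ := by
      refine ENNReal.ofReal_le_ofReal (pow_le_of_le_one (by positivity) ?_ (by omega))
      linarith [Real.exp_one_lt_d9]

end Network

/-! ### Poisson sums. -/

lemma lintegral_poissonMeasure (r : ℝ≥0) (ψ : ℕ → ℝ≥0∞) :
    ∫⁻ k, ψ k ∂(poissonMeasure r)
      = ∑' k : ℕ, ENNReal.ofReal (Real.exp (-r) * r ^ k / k.factorial) * ψ k := by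
  rw [poissonMeasure, lintegral_sum_measure]
  simp

lemma tsum_poisson_eq_one (r : ℝ≥0) :
    ∑' k : ℕ, ENNReal.ofReal (Real.exp (-r) * r ^ k / k.factorial) = 1 := by
  have h := lintegral_poissonMeasure r fun _ => 1
  simpa using h.symm

lemma tsum_poisson_mul (r : ℝ≥0) :
    ∑' k : ℕ, ENNReal.ofReal (Real.exp (-r) * r ^ k / k.factorial) * (k : ℝ≥0∞) = r := by
  rw [tsum_eq_zero_add' ENNReal.summable]
  have h : ∀ k : ℕ, ENNReal.ofReal (Real.exp (-r) * r ^ (k + 1) / (k + 1).factorial)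
      * ((k + 1 : ℕ) : ℝ≥0∞) = r * ENNReal.ofReal (Real.exp (-r) * r ^ k / k.factorial) := by
    intro k
    rw [← ENNReal.ofReal_natCast, ← ENNReal.ofReal_mul (by positivity),
      ← ENNReal.ofReal_coe_nnreal, ← ENNReal.ofReal_mul (by positivity), Nat.factorial_succ]
    congr 1
    push_cast
    field_simp
    ring
  simp only [h]
  rw [ENNReal.tsum_mul_left, tsum_poisson_eq_one]
  simp

/-- For `k ≥ 3` one has `1 / (k - 2) ≤ 4 / (k + 1)`, with equality at `k = 3`, and dividing the
Poisson weight at `k` by `k + 1` gives the weight at `k + 1` divided by `r`. -/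
lemma tsum_poisson_div_le {r : ℝ≥0} (hr : r ≠ 0) :
    ∑' k : ℕ, ENNReal.ofReal (Real.exp (-r) * r ^ k / k.factorial) *
      (if 3 ≤ k then ((k - 2 : ℕ) : ℝ≥0∞)⁻¹ else 0) ≤ ENNReal.ofReal (4 / r) := by
  have hr' : (0 : ℝ) < r := by positivity
  have h : ∀ k : ℕ, ENNReal.ofReal (Real.exp (-r) * r ^ k / k.factorial) *
      (if 3 ≤ k then ((k - 2 : ℕ) : ℝ≥0∞)⁻¹ else 0)
      ≤ ENNReal.ofReal (4 / r)
        * ENNReal.ofReal (Real.exp (-r) * r ^ (k + 1) / (k + 1).factorial) := by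
    intro k
    split_ifs with hk
    · obtain ⟨j, rfl⟩ := Nat.exists_eq_add_of_le' hk
      rw [show j + 3 - 2 = j + 1 by omega, ← ENNReal.ofReal_natCast,
        ← ENNReal.ofReal_inv_of_pos (by positivity), ← ENNReal.ofReal_mul (by positivity),
        ← ENNReal.ofReal_mul (by positivity)]
      refine ENNReal.ofReal_le_ofReal ?_
      rw [Nat.factorial_succ (j + 3), pow_succ (r : ℝ) (j + 3)]
      have e : (4 / r * (Real.exp (-r) * (r ^ (j + 3) * r) / ((j + 3 + 1) * (j + 3).factorial : ℕ)))
          = Real.exp (-r) * r ^ (j + 3) / (j + 3).factorial * (4 / (j + 4)) := by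
        push_cast
        field_simp
        ring
      rw [e]
      refine mul_le_mul_of_nonneg_left ?_ (by positivity)
      push_cast
      rw [inv_eq_one_div, div_le_div_iff₀ (by positivity) (by positivity)]
      linarith
    · simp
  calc _ ≤ _ := ENNReal.tsum_le_tsum h
    _ = ENNReal.ofReal (4 / r) *
        ∑' k : ℕ, ENNReal.ofReal (Real.exp (-r) * r ^ (k + 1) / (k + 1).factorial) :=
        ENNReal.tsum_mul_left
    _ ≤ ENNReal.ofReal (4 / r) * 1 := by
        gcongr
        rw [← tsum_poisson_eq_one r, tsum_eq_zero_add' (f := fun k : ℕ =>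
          ENNReal.ofReal (Real.exp (-r) * r ^ k / k.factorial)) ENNReal.summable]
        exact le_add_self
    _ = _ := mul_one _

/-- The left side is `exp (-r) * (1 + r + r ^ 2 / 2)`, and the quadratic is at most `4 * exp (r /
2)`; half of the exponential decay is spent on it. -/
lemma tsum_poisson_le_two_le (r : ℝ≥0) :
    ∑' k : ℕ, ENNReal.ofReal (Real.exp (-r) * r ^ k / k.factorial) * (if k ≤ 2 then 1 else 0)
      ≤ ENNReal.ofReal (4 * Real.exp (-(r / 2))) := by
  have hr : (0 : ℝ) ≤ r := r.2
  rw [tsum_eq_sum (s := Finset.range 3)]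
  · simp only [Finset.sum_range_succ, Finset.sum_range_zero]
    norm_num
    rw [← ENNReal.ofReal_add (by positivity) (by positivity),
      ← ENNReal.ofReal_add (by positivity) (by positivity),
      show (4 : ℝ≥0∞) = ENNReal.ofReal 4 by simp, ← ENNReal.ofReal_mul (by norm_num)]
    refine ENNReal.ofReal_le_ofReal ?_
    have h1 : Real.exp (-r) = Real.exp (-(r / 2)) * Real.exp (-(r / 2)) := by
      rw [← Real.exp_add]; ring_nf
    have h2 : Real.exp (-(r / 2)) * Real.exp (r / 2) = 1 := by rw [← Real.exp_add]; simp
    have h3 := Real.quadratic_le_exp_of_nonneg (x := (r : ℝ) / 2) (by positivity)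
    have h4 : 0 < Real.exp (-((r : ℝ) / 2)) := Real.exp_pos _
    rw [h1]
    have h5 : 1 + (r : ℝ) + r ^ 2 / 2 ≤ 4 * Real.exp (r / 2) := by nlinarith
    calc _ = Real.exp (-(r / 2)) * (Real.exp (-(r / 2)) * (1 + (r : ℝ) + r ^ 2 / 2)) := by ring
      _ ≤ Real.exp (-(r / 2)) * (Real.exp (-(r / 2)) * (4 * Real.exp (r / 2))) := by gcongr
      _ = 4 * Real.exp (-(r / 2)) * (Real.exp (-(r / 2)) * Real.exp (r / 2)) := by ring
      _ = _ := by rw [h2, mul_one]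
  · intro k hk
    rw [Finset.mem_range, not_lt] at hk
    rw [if_neg (by omega), mul_zero]

/-! ### Counts and intensity of the Poisson process. -/

lemma volume_plane_ball (r : ℝ) : volume (Metric.ball (0 : EuclideanSpace ℝ (Fin 2)) r)
    = ENNReal.ofReal r ^ 2 * ENNReal.ofReal Real.pi := by
  rw [InnerProductSpace.volume_ball_of_dim_even (k := 1) (by simp)]
  simp

lemma pointCount_eq_tsum {Ω : Type*} (X : ℕ → Ω → EuclideanSpace ℝ (Fin 2))
    (A : Set (EuclideanSpace ℝ (Fin 2))) (ω : Ω) :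
    ((pointCount X A ω : ℕ∞) : ℝ≥0∞) = ∑' i, A.indicator 1 (X i ω) := by
  rw [pointCount, ← ENNReal.tsum_set_one,
    tsum_subtype {i | X i ω ∈ A} fun _ => (1 : ℝ≥0∞)]
  rfl

section PointProcess

variable {Ω : Type*} [MeasurableSpace Ω] {P : Measure Ω} {lam : ℝ}
  {X : ℕ → Ω → EuclideanSpace ℝ (Fin 2)} {A : Set (EuclideanSpace ℝ (Fin 2))}

lemma IsOrderedHPPP.lintegral_count (hX : IsOrderedHPPP P lam X) (hA : MeasurableSet A)
    (hAv : volume A ≠ ∞) (ψ : ℕ∞ → ℝ≥0∞) :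
    ∫⁻ ω, ψ (pointCount X A ω) ∂P
      = ∑' k : ℕ, ENNReal.ofReal (Real.exp (-(ENNReal.ofReal lam * volume A).toNNReal)
          * (ENNReal.ofReal lam * volume A).toNNReal ^ k / k.factorial) * ψ k := by
  rw [(hX.count_law A hA hAv).lintegral_comp (f := ψ) Measurable.of_discrete.aemeasurable,
    lintegral_map Measurable.of_discrete Measurable.of_discrete, lintegral_poissonMeasure]

/-- The mean number of points in a set is its Poisson mean. The count law is available only for
finite volume, hence the exhaustion by balls. -/
lemma IsOrderedHPPP.sum_map (hX : IsOrderedHPPP P lam X) :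
    Measure.sum (fun i => P.map (X i)) = ENNReal.ofReal lam • volume := by
  rw [Measure.ext_iff_of_iUnion_eq_univ
    (s := fun n : ℕ => Metric.ball (0 : EuclideanSpace ℝ (Fin 2)) n) (Metric.iUnion_ball_nat 0)]
  intro n
  ext A hA
  rw [Measure.restrict_apply hA, Measure.restrict_apply hA]
  set B := A ∩ Metric.ball (0 : EuclideanSpace ℝ (Fin 2)) n
  have hB : MeasurableSet B := hA.inter measurableSet_ball
  have hBv : volume B ≠ ∞ := ((measure_mono inter_subset_right).trans_lt measure_ball_lt_top).ne
  have h := hX.lintegral_count hB hBv (fun c => (c : ℝ≥0∞))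
  simp only [ENat.toENNReal_coe, tsum_poisson_mul, pointCount_eq_tsum] at h
  have hm : ∀ i, Measurable fun ω => B.indicator (1 : EuclideanSpace ℝ (Fin 2) → ℝ≥0∞) (X i ω) := fun i =>
    (measurable_one.indicator hB).comp (hX.measurable i)
  rw [lintegral_tsum fun i => (hm i).aemeasurable,
    ENNReal.coe_toNNReal (ENNReal.mul_ne_top ENNReal.ofReal_ne_top hBv)] at h
  rw [Measure.sum_apply _ hB, Measure.smul_apply, smul_eq_mul, ← h]
  refine tsum_congr fun i => ?_
  rw [← lintegral_indicator_one hB,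
    lintegral_map (measurable_one.indicator hB) (hX.measurable i)]

/-- Campbell's formula. -/
lemma IsOrderedHPPP.tsum_lintegral (hX : IsOrderedHPPP P lam X)
    {f : EuclideanSpace ℝ (Fin 2) → ℝ≥0∞} (hf : Measurable f) :
    ∑' i, ∫⁻ ω, f (X i ω) ∂P = ENNReal.ofReal lam * ∫⁻ x, f x := by
  rw [← smul_eq_mul, ← lintegral_smul_measure, ← hX.sum_map, lintegral_sum_measure]
  exact tsum_congr fun i => (lintegral_map hf (hX.measurable i)).symm

lemma IsOrderedHPPP.nullMeasurableSet_count (hX : IsOrderedHPPP P lam X) (hA : MeasurableSet A)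
    (hAv : volume A ≠ ∞) (s : Set ℕ∞) : NullMeasurableSet {ω | pointCount X A ω ∈ s} P :=
  (hX.count_law A hA hAv).aemeasurable.nullMeasurable (MeasurableSet.of_discrete (s := s))

lemma IsOrderedHPPP.measure_count_le_two (hX : IsOrderedHPPP P lam X) (hA : MeasurableSet A)
    (hAv : volume A ≠ ∞) :
    P {ω | pointCount X A ω ≤ 2}
      ≤ ENNReal.ofReal (4 * Real.exp (-((ENNReal.ofReal lam * volume A).toReal / 2))) := by
  have h := hX.lintegral_count hA hAv (indicator (Iic 2) 1)
  have h1 : ∫⁻ ω, (Iic 2 : Set ℕ∞).indicator 1 (pointCount X A ω) ∂P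
      = P {ω | pointCount X A ω ≤ 2} := by
    have h2 : NullMeasurableSet {ω | pointCount X A ω ≤ 2} P :=
      hX.nullMeasurableSet_count hA hAv (Iic 2)
    rw [← lintegral_indicator_one₀ h2]
    rfl
  rw [← h1, h]
  refine le_trans (le_of_eq (tsum_congr fun k => ?_)) (tsum_poisson_le_two_le _)
  congr 1
  by_cases hk : k ≤ 2
  · have : (k : ℕ∞) ≤ 2 := by exact_mod_cast hk
    simp [hk, this]
  · have : ¬ (k : ℕ∞) ≤ 2 := by exact_mod_cast hk
    simp [hk, this]

lemma IsOrderedHPPP.lintegral_inv_count_le (hX : IsOrderedHPPP P lam X) (hA : MeasurableSet A)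
    (hAv : volume A ≠ ∞) (hpos : 0 < (ENNReal.ofReal lam * volume A).toReal) :
    ∫⁻ ω, (if 3 ≤ pointCount X A ω then ((pointCount X A ω - 2 : ℕ∞) : ℝ≥0∞)⁻¹ else 0) ∂P
      ≤ ENNReal.ofReal (4 / (ENNReal.ofReal lam * volume A).toReal) := by
  have h := hX.lintegral_count hA hAv (fun c => if 3 ≤ c then ((c - 2 : ℕ∞) : ℝ≥0∞)⁻¹ else 0)
  rw [h]
  refine le_trans (le_of_eq (tsum_congr fun k => ?_)) (tsum_poisson_div_le ?_)
  · congr 1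
    have : (3 ≤ (k : ℕ∞)) ↔ 3 ≤ k := by exact_mod_cast Iff.rfl
    simp only [this]
    congr 2
  · intro h0
    simp [ENNReal.toReal, h0] at hpos

end PointProcess

lemma le_two_of_lt_three {c : ℕ∞} (h : c < 3) : c ≤ 2 := by
  obtain ⟨k, rfl⟩ := ENat.ne_top_iff_exists.1 (h.trans_le le_top).ne
  have h' : k < 3 := by exact_mod_cast h
  exact_mod_cast Nat.le_of_lt_succ h'

/-! ### Interference power, and the SINR in terms of it. -/

lemma PhysicallyFeasible.measurable_norm {L : ℝ → ℝ} (hL : PhysicallyFeasible L) :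
    Measurable fun x : EuclideanSpace ℝ (Fin 2) => L ‖x‖ :=
  hL.measurable.comp _root_.measurable_norm

/-- Polar coordinates: this is the integrability of `r * L r` up to the factor from the angle. -/
lemma PhysicallyFeasible.lintegral_lt_top {L : ℝ → ℝ} (hL : PhysicallyFeasible L) :
    ∫⁻ x : EuclideanSpace ℝ (Fin 2), ENNReal.ofReal (L ‖x‖) < ∞ := by
  have h : Integrable (fun x : EuclideanSpace ℝ (Fin 2) => L ‖x‖) := by
    rw [integrable_fun_norm_addHaar volume (f := L)]
    simpa using hL.integrableOn
  exact h.lintegral_lt_top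

lemma IsOrderedHPPP.ae_count_ne_top {Ω : Type*} [MeasurableSpace Ω] {P : Measure Ω} {lam : ℝ}
    {X : ℕ → Ω → EuclideanSpace ℝ (Fin 2)} {A : Set (EuclideanSpace ℝ (Fin 2))}
    (hX : IsOrderedHPPP P lam X) (hA : MeasurableSet A) (hAv : volume A ≠ ∞) :
    ∀ᵐ ω ∂P, pointCount X A ω ≠ ⊤ := by
  have h := hX.lintegral_count hA hAv (indicator {⊤} 1)
  have h2 : NullMeasurableSet {ω | pointCount X A ω = ⊤} P :=
    hX.nullMeasurableSet_count hA hAv {⊤}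
  have h1 : ∫⁻ ω, ({⊤} : Set ℕ∞).indicator 1 (pointCount X A ω) ∂P
      = P {ω | pointCount X A ω = ⊤} := by
    rw [← lintegral_indicator_one₀ h2]
    rfl
  rw [h1] at h
  simp only [ne_eq, ae_iff, not_not]
  rw [h]
  simp

namespace Network

variable {lam : ℝ} {Nt Nr : ℕ} (N : Network.{u} lam Nt Nr)

/-- The interference power, given the positions and the channel coefficients. -/
noncomputable def interferenceOf (L : ℝ → ℝ) (x : ℕ → EuclideanSpace ℝ (Fin 2))
    (h : ℕ → ℕ → Fin Nr → Fin Nt → ℂ) : ℝ≥0∞ :=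
  ∑' i, ENNReal.ofReal (L ‖x (i + 1)‖ * N.gainOf h (i + 1))

/-- The interference power. -/
noncomputable def interference (L : ℝ → ℝ) (ω : N.Ω) : ℝ≥0∞ :=
  ∑' i, ENNReal.ofReal (L ‖N.X (i + 1) ω‖ * N.gain (i + 1) ω)

lemma measurable_positions : Measurable fun ω i => N.X i ω :=
  measurable_pi_lambda _ N.hppp.measurable

section Channel

variable {L : ℝ → ℝ} (hL : PhysicallyFeasible L)

include hL

lemma measurable_interferenceOf :
    Measurable fun q : (ℕ → EuclideanSpace ℝ (Fin 2)) × (ℕ → ℕ → Fin Nr → Fin Nt → ℂ) =>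
      N.interferenceOf L q.1 q.2 := by
  refine Measurable.tsum fun i => Measurable.ennreal_ofReal (Measurable.mul ?_ ?_)
  · exact hL.measurable_norm.comp ((measurable_pi_apply (i + 1)).comp measurable_fst)
  · exact (N.measurable_gainOf (i + 1)).comp measurable_snd

lemma measurable_interference : Measurable (N.interference L) := by
  have h : N.interference L = (fun q : (ℕ → EuclideanSpace ℝ (Fin 2)) × _ =>
      N.interferenceOf L q.1 q.2) ∘ fun ω => (fun i => N.X i ω, N.channels ω) := rfl
  rw [h]
  exact (N.measurable_interferenceOf hL).comp
    (N.measurable_positions.prodMk N.measurable_channels)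

/-- Also valid where the series diverges: a non-summable real series and `toReal` of `∞` both take
the value `0`. -/
lemma sinr_eq (noiseVar : ℝ) (ω : N.Ω) :
    N.sinr L noiseVar ω
      = L ‖N.X 0 ω‖ * N.gain 0 ω / ((N.interference L ω).toReal + noiseVar) := by
  have h : ∀ i, 0 ≤ L ‖N.X (i + 1) ω‖ * N.gain (i + 1) ω := fun i =>
    mul_nonneg (hL.nonneg _ (norm_nonneg _)) (N.gain_nonneg _ _)
  rw [sinr, N.norm_comb, interference, ENNReal.tsum_toReal_eq fun i => ENNReal.ofReal_ne_top]
  simp only [ENNReal.toReal_ofReal (h _), one_pow, one_mul]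

lemma measurable_sinr (noiseVar : ℝ) : Measurable (N.sinr L noiseVar) := by
  have h : N.sinr L noiseVar = fun ω =>
      L ‖N.X 0 ω‖ * N.gain 0 ω / ((N.interference L ω).toReal + noiseVar) :=
    funext (N.sinr_eq hL noiseVar)
  rw [h]
  exact ((hL.measurable_norm.comp (N.hppp.measurable 0)).mul (N.measurable_gain 0)).div
    ((N.measurable_interference hL).ennreal_toReal.add_const _)

lemma sinr_nonneg {noiseVar : ℝ} (hn : 0 ≤ noiseVar) (ω : N.Ω) : 0 ≤ N.sinr L noiseVar ω := by
  rw [N.sinr_eq hL]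
  exact div_nonneg (mul_nonneg (hL.nonneg _ (norm_nonneg _)) (N.gain_nonneg _ _)) (by positivity)

/-- Interfering gains have mean one and are independent of the positions, so Campbell's formula
applies; the missing term of station `0` only helps. -/
lemma lintegral_interference_le :
    ∫⁻ ω, N.interference L ω ∂N.P
      ≤ ENNReal.ofReal lam * ∫⁻ x : EuclideanSpace ℝ (Fin 2), ENNReal.ofReal (L ‖x‖) := by
  have hLm : ∀ i, Measurable fun ω => L ‖N.X i ω‖ := fun i =>
    hL.measurable_norm.comp (N.hppp.measurable i)
  have hterm : ∀ i, ∫⁻ ω, ENNReal.ofReal (L ‖N.X (i + 1) ω‖ * N.gain (i + 1) ω) ∂N.P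
      = ∫⁻ ω, ENNReal.ofReal (L ‖N.X (i + 1) ω‖) ∂N.P := by
    intro i
    have hind : IndepFun (fun ω => ENNReal.ofReal (L ‖N.X (i + 1) ω‖))
        (fun ω => ENNReal.ofReal (N.gain (i + 1) ω)) N.P :=
      N.indep_X_H.comp
        (φ := fun x : ℕ → EuclideanSpace ℝ (Fin 2) => ENNReal.ofReal (L ‖x (i + 1)‖))
        (ψ := fun h => ENNReal.ofReal (N.gainOf h (i + 1)))
        (hL.measurable_norm.comp (measurable_pi_apply (i + 1))).ennreal_ofReal
        (N.measurable_gainOf (i + 1)).ennreal_ofReal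
    have h := lintegral_mul_eq_lintegral_mul_lintegral_of_indepFun (hLm _).ennreal_ofReal
      (N.measurable_gain _).ennreal_ofReal hind
    rw [N.lintegral_gain (Nat.succ_ne_zero i), mul_one] at h
    rw [← h]
    refine lintegral_congr fun ω => ?_
    rw [ENNReal.ofReal_mul (hL.nonneg _ (norm_nonneg _))]
    rfl
  have hm : ∀ i, Measurable fun ω => ENNReal.ofReal (L ‖N.X (i + 1) ω‖ * N.gain (i + 1) ω) :=
    fun i => ((hLm _).mul (N.measurable_gain _)).ennreal_ofReal
  unfold interference
  rw [lintegral_tsum fun i => (hm i).aemeasurable]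
  simp only [hterm]
  rw [← N.hppp.tsum_lintegral hL.measurable_norm.ennreal_ofReal, tsum_eq_zero_add'
    (f := fun i => ∫⁻ ω, ENNReal.ofReal (L ‖N.X i ω‖) ∂N.P) ENNReal.summable]
  exact le_add_self

lemma ae_interference_ne_top : ∀ᵐ ω ∂N.P, N.interference L ω ≠ ∞ := by
  have h := (N.lintegral_interference_le hL).trans_lt
    (ENNReal.mul_lt_top ENNReal.ofReal_lt_top hL.lintegral_lt_top)
  filter_upwards [ae_lt_top (N.measurable_interference hL) h.ne] with ω hω using hω.ne

lemma ofReal_sinr_le {noiseVar : ℝ} (hn : 0 ≤ noiseVar) :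
    ∀ᵐ ω ∂N.P, ENNReal.ofReal (N.sinr L noiseVar ω)
      ≤ ENNReal.ofReal (L 0) * (ENNReal.ofReal (N.gain 0 ω) * (N.interference L ω)⁻¹) := by
  filter_upwards [N.ae_interference_ne_top hL] with ω hω
  rw [N.sinr_eq hL]
  set I := (N.interference L ω).toReal
  have hI : ENNReal.ofReal I = N.interference L ω := ENNReal.ofReal_toReal hω
  have hI0 : 0 ≤ I := ENNReal.toReal_nonneg
  -- A vanishing denominator makes the real quotient `0`, so the bound is trivial there.
  rcases (add_nonneg hI0 hn).eq_or_lt with h0 | h0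
  · rw [← h0]
    simp
  · rw [ENNReal.ofReal_div_of_pos h0, ENNReal.ofReal_mul (hL.nonneg _ (norm_nonneg _)),
      div_eq_mul_inv, mul_assoc, ← hI]
    gcongr
    · exact hL.le_zero _ (norm_nonneg _)
    · linarith

lemma lintegral_sinr_le {noiseVar : ℝ} (hn : 0 ≤ noiseVar) :
    ∫⁻ ω, ENNReal.ofReal (N.sinr L noiseVar ω) ∂N.P
      ≤ ENNReal.ofReal (L 0)
        * ∫⁻ ω, ENNReal.ofReal (N.gain 0 ω) * (N.interference L ω)⁻¹ ∂N.P := by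
  have hm : Measurable fun ω => ENNReal.ofReal (N.gain 0 ω) * (N.interference L ω)⁻¹ :=
    (N.measurable_gain 0).ennreal_ofReal.mul (N.measurable_interference hL).inv
  rw [← lintegral_const_mul _ hm]
  exact lintegral_mono_ae (N.ofReal_sinr_le hL hn)

/-- Conditioning on the positions: `ω` carries the positions and `ω'` an independent copy of the
channels. -/
lemma lintegral_gain_div_interference :
    ∫⁻ ω, ENNReal.ofReal (N.gain 0 ω) * (N.interference L ω)⁻¹ ∂N.P
      = ∫⁻ ω, ∫⁻ ω', ENNReal.ofReal (N.gain 0 ω')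
        * (N.interferenceOf L (fun i => N.X i ω) (N.channels ω'))⁻¹ ∂N.P ∂N.P :=
  lintegral_of_indepFun (G := fun ω i => N.X i ω) (W := N.channels)
    (F := fun q => ENNReal.ofReal (N.gainOf q.2 0) * (N.interferenceOf L q.1 q.2)⁻¹)
    N.measurable_positions N.measurable_channels N.indep_X_H
    (((N.measurable_gainOf 0).comp measurable_snd).ennreal_ofReal.mul
      (N.measurable_interferenceOf hL).inv)

-- Among `k + 3` stations in `A` one may be the server; at least `k + 2` interferers remain, each
-- with large-scale gain at least `l`, and their sum has inverse moment `1 / (k + 1)`.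
omit hL in
lemma lintegral_gain_div_interferenceOf_le {x : ℕ → EuclideanSpace ℝ (Fin 2)}
    {A : Set (EuclideanSpace ℝ (Fin 2))} {l : ℝ} (hl : 0 < l) (hA : ∀ z ∈ A, l ≤ L ‖z‖) {k : ℕ}
    (hk : ((k + 3 : ℕ) : ℕ∞) ≤ {i | x i ∈ A}.encard) :
    ∫⁻ ω, ENNReal.ofReal (N.gain 0 ω) * (N.interferenceOf L x (N.channels ω))⁻¹ ∂N.P
      ≤ (∫⁻ ω, ENNReal.ofReal (N.gain 0 ω) ∂N.P)
        * ((ENNReal.ofReal l)⁻¹ * ((k + 1 : ℕ) : ℝ≥0∞)⁻¹) := by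
  obtain ⟨t, htA, htc⟩ := exists_subset_encard_eq hk
  have htf : t.Finite := finite_of_encard_eq_coe htc
  obtain ⟨T, rfl⟩ := htf.exists_finset_coe
  rw [encard_coe_eq_coe_finsetCard] at htc
  have hTc : T.card = k + 3 := by exact_mod_cast htc
  obtain ⟨T', hT', hc'⟩ := Finset.exists_subset_card_eq (s := T.erase 0) (n := k + 2)
    (by have := Finset.pred_card_le_card_erase (s := T) (a := 0); omega)
  -- The interferers are indexed as `i + 1`, so indices are shifted down; this is injective once `0`
  -- is removed.
  have hinj : Set.InjOn Nat.pred (T' : Set ℕ) := by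
    intro i hi j hj hij
    have h1 := (Finset.mem_erase.1 (hT' hi)).1
    have h2 := (Finset.mem_erase.1 (hT' hj)).1
    simp only [Nat.pred_eq_sub_one] at hij
    omega
  set S := T'.image Nat.pred
  have hS : S.card = k + 2 := by rw [Finset.card_image_of_injOn hinj, hc']
  have hSA : ∀ i ∈ S, x (i + 1) ∈ A := by
    intro i hi
    obtain ⟨j, hj, rfl⟩ := Finset.mem_image.1 hi
    have h1 := Finset.mem_erase.1 (hT' hj)
    have h2 : j.pred + 1 = j := Nat.succ_pred_eq_of_pos (Nat.pos_of_ne_zero h1.1)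
    rw [h2]
    exact htA h1.2
  have hle : ∀ ω, ENNReal.ofReal l * ENNReal.ofReal (∑ i ∈ S, N.gain (i + 1) ω)
      ≤ N.interferenceOf L x (N.channels ω) := by
    intro ω
    rw [ENNReal.ofReal_sum_of_nonneg fun i _ => N.gain_nonneg _ _, Finset.mul_sum]
    refine le_trans (Finset.sum_le_sum fun i hi => ?_)
      (ENNReal.sum_le_tsum (f := fun i =>
        ENNReal.ofReal (L ‖x (i + 1)‖ * N.gain (i + 1) ω)) S)
    rw [← ENNReal.ofReal_mul hl.le]
    exact ENNReal.ofReal_le_ofReal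
      (mul_le_mul_of_nonneg_right (hA _ (hSA i hi)) (N.gain_nonneg _ _))
  have hl0 : ENNReal.ofReal l ≠ 0 := by simpa using hl
  calc _ ≤ ∫⁻ ω, (ENNReal.ofReal l)⁻¹ * (ENNReal.ofReal (N.gain 0 ω)
        * (ENNReal.ofReal (∑ i ∈ S, N.gain (i + 1) ω))⁻¹) ∂N.P := by
        refine lintegral_mono fun ω => ?_
        rw [mul_left_comm, ← ENNReal.mul_inv (Or.inl hl0) (Or.inl ENNReal.ofReal_ne_top)]
        gcongr
        exact hle ω
    _ = _ := by
        rw [lintegral_const_mul' _ _ (ENNReal.inv_ne_top.2 hl0),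
          N.lintegral_gain_zero_div_sum S hS]
        ring

/-- The mean gain-to-interference ratio, bounded through the number of base stations in an
increasing family of regions in which the large-scale gain is bounded below. -/
lemma lintegral_gain_div_interference_le {D : ℕ → Set (EuclideanSpace ℝ (Fin 2))} {l : ℕ → ℝ}
    (hD : ∀ n, MeasurableSet (D n)) (hDv : ∀ n, volume (D n) ≠ ∞) (hl : ∀ n, 0 < l n)
    (hanti : Antitone l) (hDl : ∀ n, ∀ z ∈ D n, l n ≤ L ‖z‖)
    (hpos : 0 < (ENNReal.ofReal lam * volume (D 0)).toReal) :
    ∫⁻ ω, ENNReal.ofReal (N.gain 0 ω) * (N.interference L ω)⁻¹ ∂N.P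
      ≤ (∫⁻ ω, ENNReal.ofReal (N.gain 0 ω) ∂N.P) *
        ((ENNReal.ofReal (l 0))⁻¹
            * ENNReal.ofReal (4 / (ENNReal.ofReal lam * volume (D 0)).toReal)
          + ∑' n, (ENNReal.ofReal (l (n + 1)))⁻¹ * ENNReal.ofReal
            (4 * Real.exp (-((ENNReal.ofReal lam * volume (D n)).toReal / 2)))) := by
  set E0 := ∫⁻ ω, ENNReal.ofReal (N.gain 0 ω) ∂N.P
  have hE0top : E0 ≠ ∞ := (N.lintegral_gain_zero_le.trans_lt
    (ENNReal.mul_lt_top (ENNReal.natCast_lt_top _) (ENNReal.natCast_lt_top _))).ne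
  have hl0 : ∀ n, (ENNReal.ofReal (l n))⁻¹ ≠ ∞ := fun n =>
    ENNReal.inv_ne_top.2 (by simpa using hl n)
  let f : N.Ω → ℝ≥0∞ := fun ω => if 3 ≤ pointCount N.X (D 0) ω then
    ((pointCount N.X (D 0) ω - 2 : ℕ∞) : ℝ≥0∞)⁻¹ else 0
  let g : ℕ → N.Ω → ℝ≥0∞ := fun n => {ω | pointCount N.X (D n) ω ≤ 2}.indicator 1
  have hset : ∀ n, NullMeasurableSet {ω | pointCount N.X (D n) ω ≤ 2} N.P := fun n =>
    N.hppp.nullMeasurableSet_count (hD n) (hDv n) (Iic 2)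
  have hf : AEMeasurable f N.P :=
    (Measurable.of_discrete (f := fun c : ℕ∞ => if 3 ≤ c then
      ((c - 2 : ℕ∞) : ℝ≥0∞)⁻¹ else 0)).comp_aemeasurable
      (N.hppp.count_law (D 0) (hD 0) (hDv 0)).aemeasurable
  have hg : ∀ n, AEMeasurable (g n) N.P := fun n => aemeasurable_one.indicator₀ (hset n)
  rw [N.lintegral_gain_div_interference hL]
  -- Use the first region holding three stations. If it is `D 0`, the whole count is exploited; if
  -- it is `D (n + 1)`, then `D n` holds at most two, and this rare event pays for the larger factor
  -- `1 / l (n + 1)`.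
  have hpt : ∀ᵐ ω ∂N.P, ∫⁻ ω', ENNReal.ofReal (N.gain 0 ω')
        * (N.interferenceOf L (fun i => N.X i ω) (N.channels ω'))⁻¹ ∂N.P
      ≤ E0 * ((ENNReal.ofReal (l 0))⁻¹ * f ω
        + ∑' n, (ENNReal.ofReal (l (n + 1)))⁻¹ * g n ω) := by
    filter_upwards [N.hppp.ae_count_ne_top (hD 0) (hDv 0)] with ω hω
    -- Set apart because the case of no suitable region needs `E0 * ∞ = ∞`.
    by_cases hE : E0 = 0
    · rw [hE, zero_mul, nonpos_iff_eq_zero]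
      have h0 := (lintegral_eq_zero_iff (N.measurable_gain 0).ennreal_ofReal).1 hE
      rw [← lintegral_zero (μ := N.P)]
      refine lintegral_congr_ae ?_
      filter_upwards [h0] with ω' h'
      rw [h', Pi.zero_apply, zero_mul]
    by_cases hex : ∃ n, 3 ≤ pointCount N.X (D n) ω
    · classical
      obtain ⟨n, hn, hmin⟩ : ∃ n, 3 ≤ pointCount N.X (D n) ω ∧
          ∀ m < n, ¬ 3 ≤ pointCount N.X (D m) ω :=
        ⟨Nat.find hex, Nat.find_spec hex, fun m hm => Nat.find_min hex hm⟩
      rcases n with _ | n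
      · obtain ⟨c, hc⟩ := ENat.ne_top_iff_exists.1 hω
        have hc3 : 3 ≤ c := by rw [← hc] at hn; exact_mod_cast hn
        obtain ⟨k, rfl⟩ := Nat.exists_eq_add_of_le' hc3
        refine (N.lintegral_gain_div_interferenceOf_le (hl 0) (hDl 0) (k := k) hc.le).trans ?_
        gcongr
        refine le_trans (le_of_eq ?_) le_self_add
        congr 1
        simp only [f]
        rw [if_pos hn, ← hc]
        rfl
      · have h2 : pointCount N.X (D n) ω ≤ 2 := by
          have := hmin n (Nat.lt_succ_self n)
          rw [not_le] at this
          exact le_two_of_lt_three this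
        refine (N.lintegral_gain_div_interferenceOf_le (hl (n + 1)) (hDl (n + 1)) (k := 0)
          hn).trans ?_
        gcongr
        refine le_trans ?_ le_add_self
        refine le_trans (le_of_eq ?_) (ENNReal.le_tsum n)
        simp [g, h2]
    -- With no suitable region every indicator is `1` and the series has terms at least `1 / l 0`,
    -- so the right side is infinite and nothing has to be proved.
    · push Not at hex
      have h2 : ∀ n, pointCount N.X (D n) ω ≤ 2 := fun n =>
        le_two_of_lt_three (hex n)
      have htop : ∑' n, (ENNReal.ofReal (l (n + 1)))⁻¹ * g n ω = ∞ := by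
        rw [eq_top_iff, ← ENNReal.tsum_const_eq_top_of_ne_zero (α := ℕ)
          (c := (ENNReal.ofReal (l 0))⁻¹) (by simp)]
        refine ENNReal.tsum_le_tsum fun n => ?_
        have hgn : g n ω = 1 := by simp [g, h2 n]
        rw [hgn, mul_one]
        gcongr
        exact hanti (Nat.zero_le _)
      rw [htop, add_top, ENNReal.mul_top hE]
      exact le_top
  refine (lintegral_mono_ae hpt).trans ?_
  rw [lintegral_const_mul' _ _ hE0top, lintegral_add_left' (hf.const_mul _),
    lintegral_const_mul' _ _ (hl0 0), lintegral_tsum fun n => (hg n).const_mul _]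
  gcongr with n
  · exact N.hppp.lintegral_inv_count_le (hD 0) (hDv 0) hpos
  · rw [lintegral_const_mul' _ _ (hl0 _), lintegral_indicator_one₀ (hset n)]
    gcongr
    exact N.hppp.measure_count_le_two (hD n) (hDv n)

end Channel

end Network

/-! ### Regions with a lower bound on the gain, and the resulting `1 / lam` estimate. -/

/-- The tail assumption makes the reciprocal of the channel gain grow at most like a Gaussian. -/
lemma inv_le_exp_of_integrableOn {Lt : ℝ → ℝ} {r₀ b R : ℝ} (hR : r₀ ≤ R) (hR1 : 1 ≤ R)
    (hb : 0 ≤ b) (hpos : ∀ r ∈ Ici r₀, 0 < Lt r) (hanti : AntitoneOn Lt (Ici r₀))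
    (hint : IntegrableOn (fun r => r / Lt r ^ 2 * Real.exp (-b * r ^ 2)) (Ici r₀))
    (hr₀ : 0 ≤ r₀) :
    (Lt R)⁻¹ ≤ (1 + ∫ r in Ici r₀, r / Lt r ^ 2 * Real.exp (-b * r ^ 2))
      * Real.exp (b * (R + 1) ^ 2) := by
  set J := ∫ r in Ici r₀, r / Lt r ^ 2 * Real.exp (-b * r ^ 2)
  have hsub : Ioc R (R + 1) ⊆ Ici r₀ := fun r hr => hR.trans hr.1.le
  have hLR : 0 < Lt R := hpos R hR
  -- On `(R, R + 1]` monotonicity of `Lt` and `r ≥ 1` bound the integrand below by its value at the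
  -- worst end of each factor.
  have h1 : ((Lt R)⁻¹) ^ 2 * Real.exp (-b * (R + 1) ^ 2) ≤ J := by
    calc _ = ∫ r in Ioc R (R + 1), ((Lt R)⁻¹) ^ 2 * Real.exp (-b * (R + 1) ^ 2) := by
          simp
      _ ≤ ∫ r in Ioc R (R + 1), r / Lt r ^ 2 * Real.exp (-b * r ^ 2) := by
          refine setIntegral_mono_on (integrable_const _) (hint.mono_set hsub) measurableSet_Ioc ?_
          intro r hr
          have h0 : 0 < Lt r := hpos r (hsub hr)
          have hrpos : 0 < r := by linarith [hr.1]
          have hle : Lt r ≤ Lt R := hanti hR (hsub hr) hr.1.le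
          have h3 : ((Lt R)⁻¹) ^ 2 ≤ r / Lt r ^ 2 := by
            rw [inv_pow, inv_eq_one_div]
            gcongr
            linarith [hr.1]
          have h4 : -b * (R + 1) ^ 2 ≤ -b * r ^ 2 := by
            have : r ^ 2 ≤ (R + 1) ^ 2 := by
              have := hr.2
              gcongr
            nlinarith
          gcongr
      _ ≤ J := by
          refine setIntegral_mono_set hint ?_ hsub.eventuallyLE
          refine ae_restrict_of_forall_mem measurableSet_Ici fun r hr => ?_
          have := hr₀.trans hr
          have := hpos r hr
          positivity
  have h2 : (Lt R)⁻¹ ≤ 1 + ((Lt R)⁻¹) ^ 2 := by nlinarith [sq_nonneg ((Lt R)⁻¹ - 1)]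
  have h3 : Real.exp (-b * (R + 1) ^ 2) * Real.exp (b * (R + 1) ^ 2) = 1 := by
    rw [← Real.exp_add]
    simp
  have h4 : ((Lt R)⁻¹) ^ 2 ≤ J * Real.exp (b * (R + 1) ^ 2) := by
    calc _ = ((Lt R)⁻¹) ^ 2 * Real.exp (-b * (R + 1) ^ 2) * Real.exp (b * (R + 1) ^ 2) := by
          rw [mul_assoc, h3, mul_one]
      _ ≤ _ := by gcongr
  have h5 : 1 ≤ Real.exp (b * (R + 1) ^ 2) := Real.one_le_exp (by positivity)
  linarith

lemma exists_le_of_near {L : ℝ → ℝ} (hL : PhysicallyFeasible L)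
    (hNear : ∃ a : ℝ, 0 < a ∧ ∀ᶠ r in 𝓝[>] (0 : ℝ), a ≤ L r) :
    ∃ a ε : ℝ, 0 < a ∧ 0 < ε ∧ ∀ r, 0 ≤ r → r < ε → a ≤ L r := by
  obtain ⟨a, ha, h⟩ := hNear
  obtain ⟨ε, hε, hsub⟩ := mem_nhdsGT_iff_exists_Ioo_subset.1 h
  -- The minimum covers `r = 0`, about which a right-neighbourhood filter says nothing.
  refine ⟨min a (L 0), ε, lt_min ha hL.zero_pos, hε, fun r h0 hr => ?_⟩
  rcases h0.eq_or_lt with rfl | h0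
  · exact min_le_right _ _
  · exact (min_le_left _ _).trans (hsub ⟨h0, hr⟩)

/-- A disc around the origin together with growing annuli, on which the channel gain is bounded
below by constants decaying at most like a Gaussian. -/
lemma exists_shells {L : ℝ → ℝ} (hTail : TailAssumption L) {a ε : ℝ} (ha : 0 < a) (hε : 0 < ε)
    (hnear : ∀ r, 0 ≤ r → r < ε → a ≤ L r) :
    ∃ (D : ℕ → Set (EuclideanSpace ℝ (Fin 2))) (l : ℕ → ℝ) (κ v₀ : ℝ),
      (∀ n, MeasurableSet (D n)) ∧ (∀ n, volume (D n) ≠ ∞) ∧ (∀ n, 0 < l n) ∧ Antitone l ∧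
      (∀ n, ∀ z ∈ D n, l n ≤ L ‖z‖) ∧ 0 < κ ∧ 0 < v₀ ∧
      (∀ n : ℕ, v₀ + (n : ℝ) ^ 2 ≤ (volume (D n)).toReal) ∧
      ∑' n : ℕ, (ENNReal.ofReal (l (n + 1)))⁻¹ * ENNReal.ofReal (Real.exp (-(κ * (n : ℝ) ^ 2)))
        ≠ ∞ := by
  obtain ⟨r₀, hr₀, ζ, hζ, Lt, hpos, -, hanti, hle, -, lc, hlc, hint⟩ := hTail
  obtain ⟨ρ, hρ⟩ : ∃ ρ, ρ = max (max r₀ ε) 1 := ⟨_, rfl⟩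
  have hρr : r₀ ≤ ρ := hρ ▸ (le_max_left _ _).trans (le_max_left _ _)
  have hρε : ε ≤ ρ := hρ ▸ (le_max_right _ _).trans (le_max_left _ _)
  have hρ1 : 1 ≤ ρ := hρ ▸ le_max_right _ _
  have hρn : ∀ n : ℕ, r₀ ≤ ρ + n := fun n => hρr.trans (by simp)
  set b : ℝ := Real.pi * (lc + 1)
  have hb : 0 ≤ b := by positivity
  have hint' := hint (lc + 1) (by linarith)
  have hbeq : ∀ r : ℝ, -Real.pi * (lc + 1) * r ^ 2 = -b * r ^ 2 := fun r => by
    simp only [b]; ring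
  simp only [hbeq] at hint'
  set J := ∫ r in Ici r₀, r / Lt r ^ 2 * Real.exp (-b * r ^ 2)
  have hJ : 0 ≤ J := setIntegral_nonneg measurableSet_Ici fun r hr => by
    have h1 : 0 ≤ r := hr₀.trans hr
    have := hpos r hr
    positivity
  -- The ring between `ε` and `ρ` is left out, since no positive lower bound on `L` is known
  -- throughout it.
  let D : ℕ → Set (EuclideanSpace ℝ (Fin 2)) := fun n =>
    Metric.ball 0 ε ∪ (Metric.ball 0 (ρ + n) \ Metric.ball 0 ρ)
  have hDm : ∀ n, MeasurableSet (D n) := fun n =>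
    measurableSet_ball.union (measurableSet_ball.diff measurableSet_ball)
  have hDv : ∀ n, volume (D n) ≠ ∞ := fun n => (measure_union_lt_top measure_ball_lt_top
    ((measure_mono sdiff_subset).trans_lt measure_ball_lt_top)).ne
  -- In `κ = 2 * b + 1` the part `2 * b` cancels the growth of `1 / l (n + 1)`, since `(ρ + n + 2) ^
  -- 2 ≤ 2 * (ρ + 2) ^ 2 + 2 * n ^ 2`; the extra `1` makes the series summable. The area bound `v₀`
  -- is that of the disc.
  refine ⟨D, fun n => min a (Lt (ρ + n)), 2 * b + 1, Real.pi * ε ^ 2, hDm, hDv,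
    fun n => lt_min ha (hpos _ (hρn n)), ?_, ?_, by positivity, by positivity, ?_, ?_⟩
  · intro m n hmn
    refine min_le_min_left _ (hanti (hρn m) (hρn n) ?_)
    gcongr
  · rintro n z (hz | ⟨hz, hz'⟩)
    · rw [mem_ball_zero_iff] at hz
      exact (min_le_left _ _).trans (hnear _ (norm_nonneg _) hz)
    · rw [mem_ball_zero_iff] at hz hz'
      rw [not_lt] at hz'
      have h1 : r₀ ≤ ‖z‖ := hρr.trans hz'
      exact (min_le_right _ _).trans ((hanti h1 (hρn n) hz.le).trans (hle _ h1))
  · intro n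
    have hdisj : Disjoint (Metric.ball (0 : EuclideanSpace ℝ (Fin 2)) ε)
        (Metric.ball 0 (ρ + n) \ Metric.ball 0 ρ) :=
      Set.disjoint_sdiff_right.mono_left (Metric.ball_subset_ball hρε)
    have hsub : Metric.ball (0 : EuclideanSpace ℝ (Fin 2)) ρ ⊆ Metric.ball 0 (ρ + n) :=
      Metric.ball_subset_ball (by simp)
    have hball : ∀ r : ℝ, 0 ≤ r → volume.real (Metric.ball (0 : EuclideanSpace ℝ (Fin 2)) r)
        = r ^ 2 * Real.pi := by
      intro r hr
      rw [measureReal_def, volume_plane_ball, ENNReal.toReal_mul, ENNReal.toReal_pow,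
        ENNReal.toReal_ofReal hr, ENNReal.toReal_ofReal Real.pi_pos.le]
    rw [← measureReal_def, measureReal_union hdisj (measurableSet_ball.diff measurableSet_ball)
      measure_ball_lt_top.ne (measure_ne_top_of_subset sdiff_subset measure_ball_lt_top.ne),
      measureReal_sdiff hsub measurableSet_ball measure_ball_lt_top.ne, hball _ hε.le,
      hball _ (by positivity), hball _ (by positivity)]
    have hn : (0 : ℝ) ≤ n := Nat.cast_nonneg n
    have h3 := Real.pi_gt_three
    have : (n : ℝ) ^ 2 ≤ Real.pi * n ^ 2 := by nlinarith [sq_nonneg (n : ℝ)]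
    nlinarith [mul_nonneg (mul_nonneg (by linarith : 0 ≤ ρ) hn) Real.pi_pos.le]
  · set K : ℝ := (a⁻¹ + (1 + J)) * Real.exp (b * (2 * (ρ + 2) ^ 2))
    have hterm : ∀ n : ℕ, (ENNReal.ofReal (min a (Lt (ρ + (n + 1 : ℕ)))))⁻¹
        * ENNReal.ofReal (Real.exp (-((2 * b + 1) * (n : ℝ) ^ 2)))
        ≤ ENNReal.ofReal K * ENNReal.ofReal (Real.exp (-1) ^ n) := by
      intro n
      set R := ρ + (n + 1 : ℕ)
      have hR : r₀ ≤ R := hρn _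
      have hR1 : 1 ≤ R := hρ1.trans (by simp [R]; positivity)
      have hLR := hpos R hR
      rw [← ENNReal.ofReal_inv_of_pos (lt_min ha hLR), ← ENNReal.ofReal_mul (by positivity),
        ← ENNReal.ofReal_mul (by positivity)]
      refine ENNReal.ofReal_le_ofReal ?_
      have h1 := inv_le_exp_of_integrableOn hR hR1 hb hpos hanti hint' hr₀
      have hE : Real.exp (b * (R + 1) ^ 2) ≤ Real.exp (b * (2 * (ρ + 2) ^ 2))
          * Real.exp (2 * b * (n : ℝ) ^ 2) := by
        rw [← Real.exp_add]
        refine Real.exp_le_exp.2 ?_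
        have : (R + 1) ^ 2 ≤ 2 * (ρ + 2) ^ 2 + 2 * (n : ℝ) ^ 2 := by
          simp only [R]
          push_cast
          nlinarith [sq_nonneg (ρ + 2 - n)]
        nlinarith
      have h2 : (min a (Lt R))⁻¹ ≤ K * Real.exp (2 * b * (n : ℝ) ^ 2) := by
        have h3 : (min a (Lt R))⁻¹ ≤ a⁻¹ + (Lt R)⁻¹ := by
          rcases min_cases a (Lt R) with ⟨h, _⟩ | ⟨h, _⟩ <;> rw [h]
          · have := inv_pos.2 hLR; linarith
          · have := inv_pos.2 ha; linarith
        have h4 : 1 ≤ Real.exp (b * (2 * (ρ + 2) ^ 2)) * Real.exp (2 * b * (n : ℝ) ^ 2) := by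
          rw [← Real.exp_add]
          exact Real.one_le_exp (by positivity)
        calc _ ≤ a⁻¹ + (1 + J) * Real.exp (b * (R + 1) ^ 2) := by linarith
          _ ≤ a⁻¹ * (Real.exp (b * (2 * (ρ + 2) ^ 2)) * Real.exp (2 * b * (n : ℝ) ^ 2))
              + (1 + J) * (Real.exp (b * (2 * (ρ + 2) ^ 2)) * Real.exp (2 * b * (n : ℝ) ^ 2)) := by
              gcongr
              exact le_mul_of_one_le_right (by positivity) h4
          _ = _ := by simp only [K]; ring
      have h5 : Real.exp (2 * b * (n : ℝ) ^ 2) * Real.exp (-((2 * b + 1) * (n : ℝ) ^ 2))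
          ≤ Real.exp (-1) ^ n := by
        rw [← Real.exp_add, ← Real.exp_nat_mul]
        refine Real.exp_le_exp.2 ?_
        have : (n : ℝ) ≤ (n : ℝ) ^ 2 := by exact_mod_cast Nat.le_self_pow two_ne_zero n
        nlinarith
      calc _ ≤ K * Real.exp (2 * b * (n : ℝ) ^ 2) * Real.exp (-((2 * b + 1) * (n : ℝ) ^ 2)) := by
            gcongr
        _ ≤ _ := by
            rw [mul_assoc]
            gcongr
    refine ((ENNReal.tsum_le_tsum hterm).trans_lt ?_).ne
    rw [ENNReal.tsum_mul_left]
    refine ENNReal.mul_lt_top ENNReal.ofReal_lt_top ?_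
    have hsum : Summable fun n : ℕ => Real.exp (-1) ^ n :=
      summable_geometric_of_lt_one (by positivity) (by rw [Real.exp_lt_one_iff]; norm_num)
    rw [← ENNReal.ofReal_tsum_of_nonneg (fun n => by positivity) hsum]
    exact ENNReal.ofReal_lt_top

lemma exp_neg_le_inv {x : ℝ} (hx : 0 < x) : Real.exp (-x) ≤ 1 / x := by
  rw [Real.exp_neg, inv_eq_one_div]
  gcongr
  linarith [Real.add_one_le_exp x]

/-- The mean ratio of the serving gain to the interference is at most a constant times the mean
serving gain divided by the density of the base stations. -/
lemma exists_lintegral_gain_div_interference_le {L : ℝ → ℝ} (hL : PhysicallyFeasible L)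
    (hTail : TailAssumption L) {a ε : ℝ} (ha : 0 < a) (hε : 0 < ε)
    (hnear : ∀ r, 0 ≤ r → r < ε → a ≤ L r) :
    ∃ C lam₀ : ℝ, 0 < C ∧ 0 < lam₀ ∧ ∀ (lam : ℝ) (Nt Nr : ℕ), lam₀ ≤ lam →
      ∀ N : Network.{u} lam Nt Nr,
        ∫⁻ ω, ENNReal.ofReal (N.gain 0 ω) * (N.interference L ω)⁻¹ ∂N.P
          ≤ (∫⁻ ω, ENNReal.ofReal (N.gain 0 ω) ∂N.P) * ENNReal.ofReal (C / lam) := by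
  obtain ⟨D, l, κ, v₀, hD, hDv, hl, hanti, hDl, hκ, hv₀, hvol, hsum⟩ :=
    exists_shells hTail ha hε hnear
  set T := ∑' n : ℕ, (ENNReal.ofReal (l (n + 1)))⁻¹
    * ENNReal.ofReal (Real.exp (-(κ * (n : ℝ) ^ 2)))
  -- For `lam ≥ 2 * κ` the void exponent `lam * (v₀ + n ^ 2) / 2` splits into `κ * n ^ 2`, used for
  -- summation, and `lam * v₀ / 2`, where `exp (-x) ≤ 1 / x` yields `8 / (v₀ * lam)`.
  refine ⟨(l 0)⁻¹ * (4 / v₀) + T.toReal * (8 / v₀), 2 * κ, ?_, by positivity, ?_⟩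
  · have := hl 0
    have : 0 ≤ T.toReal := ENNReal.toReal_nonneg
    positivity
  intro lam Nt Nr hlam N
  have hlam0 : 0 < lam := by linarith
  have hμ : ∀ n : ℕ, lam * (v₀ + (n : ℝ) ^ 2) ≤ (ENNReal.ofReal lam * volume (D n)).toReal := by
    intro n
    rw [ENNReal.toReal_mul, ENNReal.toReal_ofReal hlam0.le]
    have := hvol n
    gcongr
  have hμ0 : lam * v₀ ≤ (ENNReal.ofReal lam * volume (D 0)).toReal := by simpa using hμ 0
  have hμpos : 0 < lam * v₀ := by positivity
  refine (N.lintegral_gain_div_interference_le hL hD hDv hl hanti hDl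
    (hμpos.trans_le hμ0)).trans ?_
  gcongr
  rw [add_div, ENNReal.ofReal_add (by have := hl 0; positivity) (by positivity)]
  have hl0 := hl 0
  refine add_le_add ?_ ?_
  · rw [← ENNReal.ofReal_inv_of_pos hl0, ← ENNReal.ofReal_mul (by positivity)]
    refine ENNReal.ofReal_le_ofReal ?_
    rw [mul_div_assoc, div_div, mul_comm v₀]
    gcongr
  · have hterm : ∀ n : ℕ, (ENNReal.ofReal (l (n + 1)))⁻¹ * ENNReal.ofReal
        (4 * Real.exp (-((ENNReal.ofReal lam * volume (D n)).toReal / 2)))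
        ≤ (ENNReal.ofReal (l (n + 1)))⁻¹ * ENNReal.ofReal (Real.exp (-(κ * (n : ℝ) ^ 2)))
          * ENNReal.ofReal (8 / v₀ / lam) := by
      intro n
      rw [mul_assoc, ← ENNReal.ofReal_mul (by positivity)]
      refine mul_le_mul' le_rfl (ENNReal.ofReal_le_ofReal ?_)
      calc _ ≤ 4 * Real.exp (-(κ * (n : ℝ) ^ 2) + -(lam * v₀ / 2)) := by
            refine mul_le_mul_of_nonneg_left (Real.exp_le_exp.2 ?_) (by norm_num)
            nlinarith [hμ n, sq_nonneg (n : ℝ)]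
        _ = Real.exp (-(κ * (n : ℝ) ^ 2)) * (4 * Real.exp (-(lam * v₀ / 2))) := by
            rw [Real.exp_add]; ring
        _ ≤ Real.exp (-(κ * (n : ℝ) ^ 2)) * (4 * (1 / (lam * v₀ / 2))) := by
            gcongr
            exact exp_neg_le_inv (by positivity)
        _ = _ := by
            congr 1
            field_simp
            norm_num
    refine (ENNReal.tsum_le_tsum hterm).trans ?_
    rw [ENNReal.tsum_mul_right, mul_div_assoc, ENNReal.ofReal_mul ENNReal.toReal_nonneg,
      ENNReal.ofReal_toReal hsum]

/-! ### Logarithmic inequalities and Jensen. -/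

/-- Bernoulli's inequality for real exponents; together with its reverse for exponents in `[0, 1]`
it moves constants out of the logarithm. -/
lemma log_one_add_mul_le {C x : ℝ} (hC : 1 ≤ C) (hx : 0 ≤ x) :
    Real.log (1 + C * x) ≤ C * Real.log (1 + x) := by
  rw [← Real.log_rpow (by linarith)]
  exact Real.log_le_log (by positivity) (one_add_mul_self_le_rpow_one_add (by linarith) hC)

lemma mul_log_one_add_le {c x : ℝ} (hc0 : 0 ≤ c) (hc : c ≤ 1) (hx : 0 ≤ x) :
    c * Real.log (1 + x) ≤ Real.log (1 + c * x) := by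
  rw [← Real.log_rpow (by linarith)]
  exact Real.log_le_log (by positivity) (rpow_one_add_le_one_add_mul_self (by linarith) hc0 hc)

section Jensen

variable {Ω : Type*} [MeasurableSpace Ω] {P : Measure Ω} {s : Ω → ℝ}

lemma integrable_log_one_add (hs0 : ∀ ω, 0 ≤ s ω) (hs : Integrable s P) :
    Integrable (fun ω => Real.log (1 + s ω)) P := by
  refine hs.mono' ?_ (ae_of_all _ fun ω => ?_)
  · exact (Real.measurable_log.comp_aemeasurable
      (hs.aemeasurable.const_add 1)).aestronglyMeasurable
  · have := hs0 ω
    rw [Real.norm_of_nonneg (Real.log_nonneg (by linarith))]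
    linarith [Real.log_le_sub_one_of_pos (x := 1 + s ω) (by linarith)]

lemma integral_log_one_add_le [IsProbabilityMeasure P] (hs0 : ∀ ω, 0 ≤ s ω)
    (hs : Integrable s P) :
    ∫ ω, Real.log (1 + s ω) ∂P ≤ Real.log (1 + ∫ ω, s ω ∂P) := by
  obtain ⟨m, hm⟩ : ∃ m, m = ∫ ω, s ω ∂P := ⟨_, rfl⟩
  have hm0 : 0 ≤ m := hm ▸ integral_nonneg hs0
  rw [← hm]
  -- Tangent line of the concave function `log (1 + ·)` at the mean `m`; integrating it gives
  -- Jensen.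
  have hpt : ∀ ω, Real.log (1 + s ω) ≤ (Real.log (1 + m) - m / (1 + m)) + s ω / (1 + m) := by
    intro ω
    have h0 := hs0 ω
    have h1 := Real.log_le_sub_one_of_pos (x := (1 + s ω) / (1 + m)) (by positivity)
    rw [Real.log_div (by positivity) (by positivity)] at h1
    have h2 : (1 + s ω) / (1 + m) - 1 = s ω / (1 + m) - m / (1 + m) := by
      field_simp
      ring
    linarith
  refine (integral_mono (integrable_log_one_add hs0 hs)
    ((integrable_const _).add (hs.div_const _)) hpt).trans ?_
  rw [integral_add' (integrable_const _) (hs.div_const _), integral_div, ← hm]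
  simp

end Jensen

/-! ### The favourable event and the two-sided bounds. -/

namespace Network

variable {lam : ℝ} {Nt Nr : ℕ} (N : Network.{u} lam Nt Nr)

/-- By the ordering, a distant nearest point means an empty ball, which is a special case of at most
two points. -/
lemma measure_le_norm_nearest {ε : ℝ} :
    N.P {ω | ε ≤ ‖N.X 0 ω‖} ≤ ENNReal.ofReal
      (4 * Real.exp (-((ENNReal.ofReal lam *
        volume (Metric.ball (0 : EuclideanSpace ℝ (Fin 2)) ε)).toReal / 2))) := by
  refine le_trans (measure_mono_ae ?_)
    (N.hppp.measure_count_le_two measurableSet_ball measure_ball_lt_top.ne)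
  filter_upwards [N.hppp.ordered] with ω hω h
  have h' : ε ≤ ‖N.X 0 ω‖ := h
  have h0 : pointCount N.X (Metric.ball 0 ε) ω = 0 := by
    rw [pointCount, encard_eq_zero, Set.eq_empty_iff_forall_notMem]
    intro i hi
    have hi' : N.X i ω ∈ Metric.ball 0 ε := hi
    rw [mem_ball_zero_iff] at hi'
    exact absurd (h'.trans (hω (Nat.zero_le i))) (not_le.2 hi')
  change pointCount N.X (Metric.ball 0 ε) ω ≤ 2
  rw [h0]
  exact zero_le

/-- With at least a fixed probability the serving base station is close, the interference is at
most a constant times the density, and the serving gain is at least a constant times `Nt`. -/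
lemma exists_measure_sinr_ge {L : ℝ → ℝ} (hL : PhysicallyFeasible L) (hTail : TailAssumption L)
    {a ε : ℝ} (ha : 0 < a) (hε : 0 < ε) (hnear : ∀ r, 0 ≤ r → r < ε → a ≤ L r)
    {noiseVar : ℝ} (hn : 0 ≤ noiseVar) :
    ∃ c lam₀ : ℝ, 0 < c ∧ 0 < lam₀ ∧ ∀ (lam : ℝ) (Nt Nr : ℕ), lam₀ ≤ lam → 1 ≤ Nt → 1 ≤ Nr →
      ∀ N : Network.{u} lam Nt Nr,
        1 / 10 ≤ N.P.real {ω | c * ((Nt : ℝ) / lam) ≤ N.sinr L noiseVar ω} := by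
  obtain ⟨C, lam₁, hC, hlam₁, hbound⟩ :=
    exists_lintegral_gain_div_interference_le.{u} hL hTail ha hε hnear
  set Γ := (∫⁻ x : EuclideanSpace ℝ (Fin 2), ENNReal.ofReal (L ‖x‖)).toReal
  have hΓ0 : 0 ≤ Γ := ENNReal.toReal_nonneg
  have hΓ : ENNReal.ofReal Γ = ∫⁻ x : EuclideanSpace ℝ (Fin 2), ENNReal.ofReal (L ‖x‖) :=
    ENNReal.ofReal_toReal hL.lintegral_lt_top.ne
  set M := 4 * (Γ + 1)
  have hM : 0 < M := by positivity
  -- `M` makes Markov's bound for the interference at most `1 / 4`. The density `32 / (π ε ^ 2)`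
  -- makes the mean count in the disc at least `32`, so that the void bound is `4 * exp (-16) ≤ 1 /
  -- 4`.
  refine ⟨a / (7 * (M + noiseVar)), max (max lam₁ 1) (32 / (Real.pi * ε ^ 2)), by positivity,
    lt_max_of_lt_left (lt_max_of_lt_right one_pos), ?_⟩
  intro lam Nt Nr hlam hNt hNr N
  have hlam1 : lam₁ ≤ lam := ((le_max_left _ _).trans (le_max_left _ _)).trans hlam
  have hlam2 : 1 ≤ lam := ((le_max_right _ _).trans (le_max_left _ _)).trans hlam
  have hlam3 : 32 / (Real.pi * ε ^ 2) ≤ lam := (le_max_right _ _).trans hlam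
  have hlam0 : 0 < lam := by linarith
  have hNt0 : (0 : ℝ) < Nt := by exact_mod_cast hNt
  set B₁ := {ω | ε ≤ ‖N.X 0 ω‖}
  set B₂ := {ω | ENNReal.ofReal (M * lam) ≤ N.interference L ω}
  set B₃ := {ω | N.gain 0 ω ≤ Nt / 7}
  have h1 : N.P B₁ ≤ ENNReal.ofReal (1 / 4) := by
    refine N.measure_le_norm_nearest.trans (ENNReal.ofReal_le_ofReal ?_)
    have hv : 32 ≤ (ENNReal.ofReal lam *
        volume (Metric.ball (0 : EuclideanSpace ℝ (Fin 2)) ε)).toReal := by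
      rw [volume_plane_ball, ENNReal.toReal_mul, ENNReal.toReal_mul, ENNReal.toReal_pow,
        ENNReal.toReal_ofReal hε.le, ENNReal.toReal_ofReal Real.pi_pos.le,
        ENNReal.toReal_ofReal hlam0.le]
      rw [div_le_iff₀ (by positivity)] at hlam3
      linarith
    calc _ ≤ 4 * Real.exp (-16) := by
          gcongr
          linarith
      _ ≤ 4 * (1 / 16) := by
          gcongr
          exact exp_neg_le_inv (by norm_num)
      _ = _ := by norm_num
  have h2 : N.P B₂ ≤ ENNReal.ofReal (1 / 4) := by
    refine (meas_ge_le_lintegral_div (N.measurable_interference hL).aemeasurable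
      (by simp only [ne_eq, ENNReal.ofReal_eq_zero, not_le]; positivity)
      ENNReal.ofReal_ne_top).trans ?_
    calc _ ≤ ENNReal.ofReal (lam * Γ) / ENNReal.ofReal (M * lam) := by
          gcongr
          rw [ENNReal.ofReal_mul hlam0.le, hΓ]
          exact N.lintegral_interference_le hL
      _ = ENNReal.ofReal (lam * Γ / (M * lam)) := by
          rw [ENNReal.ofReal_div_of_pos (by positivity)]
      _ ≤ _ := by
          refine ENNReal.ofReal_le_ofReal ?_
          rw [div_le_div_iff₀ (by positivity) (by norm_num)]
          simp only [M]
          nlinarith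
  have h3 : N.P B₃ ≤ ENNReal.ofReal (Real.exp 1 / 8) := N.measure_gain_zero_le hNt hNr
  -- This excludes zero interference when the serving gain is positive; without noise, the SINR
  -- would there be `0` by the division convention.
  have hfin : ∀ᵐ ω ∂N.P, ENNReal.ofReal (N.gain 0 ω) * (N.interference L ω)⁻¹ < ∞ := by
    refine ae_lt_top ((N.measurable_gain 0).ennreal_ofReal.mul (N.measurable_interference hL).inv)
      ((hbound lam Nt Nr hlam1 N).trans_lt ?_).ne
    exact ENNReal.mul_lt_top (N.lintegral_gain_zero_le.trans_lt
      (ENNReal.mul_lt_top (ENNReal.natCast_lt_top _) (ENNReal.natCast_lt_top _)))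
      ENNReal.ofReal_lt_top
  set G := {ω | a / (7 * (M + noiseVar)) * ((Nt : ℝ) / lam) ≤ N.sinr L noiseVar ω}
  have hGm : MeasurableSet G := measurableSet_le measurable_const (N.measurable_sinr hL noiseVar)
  have hcompl : N.P Gᶜ ≤ N.P (B₁ ∪ B₂ ∪ B₃) := by
    refine measure_mono_ae ?_
    filter_upwards [hfin] with ω hω hG
    by_contra hB
    refine hG ?_
    have hB' : ω ∉ B₁ ∪ B₂ ∪ B₃ := hB
    simp only [mem_union, not_or, B₁, B₂, B₃, mem_ofPred_eq, not_le] at hB'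
    obtain ⟨⟨hb1, hb2⟩, hb3⟩ := hB'
    have hgpos : 0 < N.gain 0 ω := lt_trans (by positivity) hb3
    have hI0 : N.interference L ω ≠ 0 := by
      intro h0
      rw [h0, ENNReal.inv_zero, ENNReal.mul_top (by simpa using hgpos)] at hω
      exact lt_irrefl _ hω
    have hItop : N.interference L ω ≠ ∞ := (hb2.trans ENNReal.ofReal_lt_top).ne
    have hIpos : 0 < (N.interference L ω).toReal := ENNReal.toReal_pos hI0 hItop
    have hIle : (N.interference L ω).toReal ≤ M * lam :=
      ENNReal.toReal_le_of_le_ofReal (by positivity) hb2.le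
    change a / (7 * (M + noiseVar)) * ((Nt : ℝ) / lam) ≤ N.sinr L noiseVar ω
    rw [N.sinr_eq hL]
    calc a / (7 * (M + noiseVar)) * ((Nt : ℝ) / lam)
        = a * (Nt / 7) / (M * lam + noiseVar * lam) := by field_simp
      _ ≤ L ‖N.X 0 ω‖ * N.gain 0 ω / ((N.interference L ω).toReal + noiseVar) := by
          have hLa := hnear _ (norm_nonneg _) hb1
          have : noiseVar ≤ noiseVar * lam := le_mul_of_one_le_right hn hlam2
          have := hL.nonneg _ (norm_nonneg (N.X 0 ω))
          gcongr
  have hB : N.P (B₁ ∪ B₂ ∪ B₃) ≤ ENNReal.ofReal (9 / 10) := by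
    refine (measure_union_le _ _).trans ((add_le_add_left (measure_union_le _ _) _).trans ?_)
    refine (add_le_add (add_le_add h1 h2) h3).trans ?_
    rw [← ENNReal.ofReal_add (by norm_num) (by norm_num), ← ENNReal.ofReal_add (by norm_num)
      (by positivity)]
    refine ENNReal.ofReal_le_ofReal ?_
    -- `1 / 4 + 1 / 4 + e / 8 < 9 / 10`.
    linarith [Real.exp_one_lt_d9]
  have hreal : N.P.real Gᶜ ≤ 9 / 10 :=
    ENNReal.toReal_le_of_le_ofReal (by norm_num) (hcompl.trans hB)
  rw [probReal_compl_eq_one_sub hGm] at hreal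
  linarith

/-- Two-sided bounds for the average SINR and the average area spectral efficiency. -/
lemma exists_average_bounds {L : ℝ → ℝ} (hL : PhysicallyFeasible L) (hTail : TailAssumption L)
    (hNear : ∃ a : ℝ, 0 < a ∧ ∀ᶠ r in 𝓝[>] (0 : ℝ), a ≤ L r)
    {noiseVar : ℝ} (hn : 0 ≤ noiseVar) :
    ∃ c C lam₀ : ℝ, 0 < c ∧ 0 < C ∧ 0 < lam₀ ∧ ∀ (lam : ℝ) (Nt Nr : ℕ), lam₀ ≤ lam → 1 ≤ Nt →
      1 ≤ Nr → ∀ N : Network.{u} lam Nt Nr,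
        Integrable (N.sinr L noiseVar) N.P ∧
        c * ((Nt : ℝ) / lam) ≤ N.avgSINR L noiseVar ∧
        N.avgSINR L noiseVar ≤ C * ((Nt : ℝ) * Nr / lam) ∧
        Integrable (N.ase L noiseVar) N.P ∧
        c * (lam * Real.log (1 + (Nt : ℝ) / lam)) ≤ N.avgASE L noiseVar ∧
        N.avgASE L noiseVar ≤ C * (lam * Real.log (1 + (Nt : ℝ) * Nr / lam)) := by
  obtain ⟨a, ε, ha, hε, hnear⟩ := exists_le_of_near hL hNear
  obtain ⟨C, lam₁, hC, hlam₁, hbound⟩ :=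
    exists_lintegral_gain_div_interference_le.{u} hL hTail ha hε hnear
  obtain ⟨c, lam₂, hc, hlam₂, hevent⟩ :=
    exists_measure_sinr_ge.{u} hL hTail ha hε hnear hn
  have hL0 := hL.zero_pos
  have hlog2 : 0 < Real.log 2 := Real.log_pos one_lt_two
  -- The maximum with `1` is what Bernoulli's inequality requires; the minimum `min c 1` below plays
  -- the dual role.
  set K := max (L 0 * C) 1
  refine ⟨min (c / 10) (min c 1 / 10 / Real.log 2), max K (K / Real.log 2), max lam₁ lam₂,
    by positivity, by positivity, by positivity, ?_⟩
  intro lam Nt Nr hlam hNt hNr N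
  have hlam0 : 0 < lam := hlam₁.trans_le ((le_max_left _ _).trans hlam)
  have hb := hbound lam Nt Nr ((le_max_left _ _).trans hlam) N
  have he := hevent lam Nt Nr ((le_max_right _ _).trans hlam) hNt hNr N
  set s := N.sinr L noiseVar
  have hsm : Measurable s := N.measurable_sinr hL noiseVar
  have hs0 : ∀ ω, 0 ≤ s ω := N.sinr_nonneg hL hn
  have hsle : ∫⁻ ω, ENNReal.ofReal (s ω) ∂N.P
      ≤ ENNReal.ofReal (L 0 * C * ((Nt : ℝ) * Nr / lam)) := by
    calc _ ≤ ENNReal.ofReal (L 0) * ((Nt : ℝ≥0∞) * Nr * ENNReal.ofReal (C / lam)) := by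
          refine (N.lintegral_sinr_le hL hn).trans ?_
          gcongr
          refine hb.trans ?_
          gcongr
          exact N.lintegral_gain_zero_le
      _ = _ := by
          rw [← ENNReal.ofReal_natCast, ← ENNReal.ofReal_natCast,
            ← ENNReal.ofReal_mul (by positivity), ← ENNReal.ofReal_mul (by positivity),
            ← ENNReal.ofReal_mul (by positivity)]
          congr 1
          ring
  have hsint : Integrable s N.P :=
    (lintegral_ofReal_ne_top_iff_integrable hsm.aestronglyMeasurable (ae_of_all _ hs0)).1
      (hsle.trans_lt ENNReal.ofReal_lt_top).ne
  have hmean : ∫ ω, s ω ∂N.P ≤ L 0 * C * ((Nt : ℝ) * Nr / lam) := by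
    rw [integral_eq_lintegral_of_nonneg_ae (ae_of_all _ hs0) hsm.aestronglyMeasurable]
    exact ENNReal.toReal_le_of_le_ofReal (by positivity) hsle
  have hm0 : 0 ≤ ∫ ω, s ω ∂N.P := integral_nonneg hs0
  -- Markov's inequality read backwards: a nonnegative function at least `t` on the favourable event
  -- has mean at least `t / 10`. It is used for the SINR and for its logarithm.
  have hmarkov : ∀ {f : N.Ω → ℝ} {t : ℝ}, (∀ ω, 0 ≤ f ω) → Integrable f N.P → 0 ≤ t →
      (∀ ω, c * ((Nt : ℝ) / lam) ≤ s ω → t ≤ f ω) → t / 10 ≤ ∫ ω, f ω ∂N.P := by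
    intro f t hf hfi ht hft
    refine le_trans ?_ (mul_meas_ge_le_integral_of_nonneg (ae_of_all _ hf) hfi t)
    have : N.P.real {ω | c * ((Nt : ℝ) / lam) ≤ s ω} ≤ N.P.real {ω | t ≤ f ω} :=
      measureReal_mono hft
    have := he.trans this
    nlinarith
  set x := (Nt : ℝ) / lam
  set z := (Nt : ℝ) * Nr / lam
  have hx : 0 ≤ x := by positivity
  have hz : 0 ≤ z := by positivity
  have hlogint := integrable_log_one_add hs0 hsint
  have hase : ∀ ω, N.ase L noiseVar ω = lam / Real.log 2 * Real.log (1 + s ω) := by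
    intro ω
    rw [ase, Real.logb]
    ring
  have havg : N.avgASE L noiseVar = lam / Real.log 2 * ∫ ω, Real.log (1 + s ω) ∂N.P := by
    rw [avgASE, ← integral_const_mul]
    simp only [hase]
  have hK1 : 1 ≤ K := le_max_right _ _
  have hKC : L 0 * C ≤ K := le_max_left _ _
  have hlogx : 0 ≤ Real.log (1 + x) := Real.log_nonneg (by linarith)
  have hlogz : 0 ≤ Real.log (1 + z) := Real.log_nonneg (by linarith)
  refine ⟨hsint, ?_, ?_, ?_, ?_, ?_⟩
  · calc _ ≤ c / 10 * x := by gcongr; exact min_le_left _ _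
      _ = c * x / 10 := by ring
      _ ≤ _ := hmarkov hs0 hsint (by positivity) fun ω h => h
  · refine hmean.trans ?_
    gcongr
    exact hKC.trans (le_max_left _ _)
  · rw [show N.ase L noiseVar = fun ω => lam / Real.log 2 * Real.log (1 + s ω) from funext hase]
    exact hlogint.const_mul _
  · have h1 : min c 1 * Real.log (1 + x) / 10 ≤ ∫ ω, Real.log (1 + s ω) ∂N.P := by
      refine hmarkov (fun ω => Real.log_nonneg (by linarith [hs0 ω])) hlogint (by positivity) ?_
      intro ω h
      refine (mul_log_one_add_le (by positivity) (min_le_right _ _) hx).trans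
        (Real.log_le_log (by positivity) ?_)
      have : min c 1 * x ≤ c * x := by gcongr; exact min_le_left _ _
      linarith
    rw [havg]
    calc _ ≤ min c 1 / 10 / Real.log 2 * (lam * Real.log (1 + x)) := by
          gcongr
          exact min_le_right _ _
      _ = lam / Real.log 2 * (min c 1 * Real.log (1 + x) / 10) := by ring
      _ ≤ _ := by gcongr
  · have hjensen := integral_log_one_add_le hs0 hsint
    have h1 : Real.log (1 + ∫ ω, s ω ∂N.P) ≤ K * Real.log (1 + z) := by
      refine le_trans (Real.log_le_log (by positivity) ?_) (log_one_add_mul_le hK1 hz)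
      have : L 0 * C * z ≤ K * z := by gcongr
      linarith
    rw [havg]
    calc _ ≤ lam / Real.log 2 * (K * Real.log (1 + z)) := by
          gcongr
          exact hjensen.trans h1
      _ = K / Real.log 2 * (lam * Real.log (1 + z)) := by ring
      _ ≤ _ := by
          gcongr
          exact le_max_right _ _

end Network

end CellularScaling

/-! ### Comparison with the MISO networks. -/

theorem corollary2
    (L : ℝ → ℝ) (hL : CellularScaling.PhysicallyFeasible L)
    (hTail : CellularScaling.TailAssumption L)
    (hNear : ∃ a : ℝ, 0 < a ∧ ∀ᶠ r in 𝓝[>] (0 : ℝ), a ≤ L r)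
    (noiseVar : ℝ) (hNoise : 0 ≤ noiseVar)
    (Nt Nr : ℝ → ℕ) (hNtMono : MonotoneOn Nt (Ici 0)) (hNtZero : Nt 0 = 0)
    (hNtTop : Tendsto Nt atTop atTop) (hNr : ∀ᶠ lam in atTop, 1 ≤ Nr lam)
    (y : ℝ) (hy : y ∈ Icc (0 : ℝ) 1)
    (hRatio : Tendsto (fun lam => (Nr lam : ℝ) / (Nt lam : ℝ)) atTop (𝓝 y)) :
    ∃ c C : ℝ, 0 < c ∧ 0 < C ∧ ∀ᶠ lam : ℝ in atTop,
      -- the average SINR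
      (∀ N : CellularScaling.Network.{u} lam (Nt lam) (Nr lam),
        Integrable (N.sinr L noiseVar) N.P ∧
        c * ((Nt lam : ℝ) / lam) ≤ N.avgSINR L noiseVar ∧
        N.avgSINR L noiseVar ≤ C * ((Nt lam : ℝ) * (Nr lam : ℝ) / lam)) ∧
      -- the average ASE, against the explicit scaling functions
      (∀ N : CellularScaling.Network.{u} lam (Nt lam) (Nr lam),
        Integrable (N.ase L noiseVar) N.P ∧
        c * (lam * Real.log (1 + (Nt lam : ℝ) / lam)) ≤ N.avgASE L noiseVar ∧
        N.avgASE L noiseVar ≤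
          C * (lam * Real.log (1 + (Nt lam : ℝ) * (Nr lam : ℝ) / lam))) ∧
      -- the average ASE, against single-antenna users and `Nt` transmit antennas
      (∀ (N : CellularScaling.Network.{u} lam (Nt lam) (Nr lam))
          (M : CellularScaling.Network.{v} lam (Nt lam) 1),
        Integrable (M.ase L noiseVar) M.P ∧
        c * M.avgASE L noiseVar ≤ N.avgASE L noiseVar) ∧
      -- the average ASE, against single-antenna users and `Nt * Nr` transmit antennas
      (∀ (N : CellularScaling.Network.{u} lam (Nt lam) (Nr lam))
          (M : CellularScaling.Network.{v} lam (Nt lam * Nr lam) 1),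
        Integrable (M.ase L noiseVar) M.P ∧
        N.avgASE L noiseVar ≤ C * M.avgASE L noiseVar) := by

  -- Two instances because the two networks may live in different universes. The comparison
  -- constants are the ratios `c₁ / C₂` and `C₁ / c₂`, obtained by passing through the explicit
  -- scaling function.
  obtain ⟨c₁, C₁, l₁, hc₁, hC₁, hl₁, h₁⟩ :=
    CellularScaling.Network.exists_average_bounds.{u} hL hTail hNear hNoise
  obtain ⟨c₂, C₂, l₂, hc₂, hC₂, hl₂, h₂⟩ :=
    CellularScaling.Network.exists_average_bounds.{v} hL hTail hNear hNoise
  refine ⟨min c₁ (c₁ / C₂), max C₁ (C₁ / c₂), by positivity, by positivity, ?_⟩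
  filter_upwards [eventually_ge_atTop l₁, eventually_ge_atTop l₂, hNr,
    hNtTop.eventually_ge_atTop 1] with lam hlam₁ hlam₂ hNr1 hNt1
  have hlam0 : 0 < lam := hl₁.trans_le hlam₁
  have hlog : ∀ x : ℝ, 0 ≤ x → 0 ≤ lam * Real.log (1 + x) := fun x hx =>
    mul_nonneg hlam0.le (Real.log_nonneg (by linarith))
  refine ⟨fun N => ?_, fun N => ?_, fun N M => ?_, fun N M => ?_⟩
  · obtain ⟨hi, hlo, hup, -, -, -⟩ := h₁ lam _ _ hlam₁ hNt1 hNr1 N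
    refine ⟨hi, le_trans ?_ hlo, hup.trans ?_⟩
    · gcongr
      exact min_le_left _ _
    · gcongr
      exact le_max_left _ _
  · obtain ⟨-, -, -, hi, hlo, hup⟩ := h₁ lam _ _ hlam₁ hNt1 hNr1 N
    refine ⟨hi, le_trans ?_ hlo, hup.trans ?_⟩
    · exact mul_le_mul_of_nonneg_right (min_le_left _ _) (hlog _ (by positivity))
    · exact mul_le_mul_of_nonneg_right (le_max_left _ _) (hlog _ (by positivity))
  · obtain ⟨-, -, -, -, hlo, -⟩ := h₁ lam _ _ hlam₁ hNt1 hNr1 N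
    obtain ⟨-, -, -, hi, hlo', hup⟩ := h₂ lam _ _ hlam₂ hNt1 le_rfl M
    rw [Nat.cast_one, mul_one] at hup
    have hM0 : 0 ≤ M.avgASE L noiseVar :=
      le_trans (mul_nonneg hc₂.le (hlog _ (by positivity))) hlo'
    refine ⟨hi, le_trans ?_ hlo⟩
    calc _ ≤ c₁ / C₂ * M.avgASE L noiseVar :=
          mul_le_mul_of_nonneg_right (min_le_right _ _) hM0
      _ ≤ c₁ / C₂ * (C₂ * (lam * Real.log (1 + (Nt lam : ℝ) / lam))) := by gcongr
      _ = _ := by field_simp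
  · obtain ⟨-, -, -, -, -, hup⟩ := h₁ lam _ _ hlam₁ hNt1 hNr1 N
    obtain ⟨-, -, -, hi, hlo, -⟩ := h₂ lam _ _ hlam₂ (Nat.mul_pos hNt1 hNr1) le_rfl M
    rw [Nat.cast_mul] at hlo
    have hM0 : 0 ≤ M.avgASE L noiseVar :=
      le_trans (mul_nonneg hc₂.le (hlog _ (by positivity))) hlo
    refine ⟨hi, hup.trans ?_⟩
    calc _ = C₁ / c₂ * (c₂ * (lam * Real.log (1 + (Nt lam : ℝ) * (Nr lam : ℝ) / lam))) := by
          field_simp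
      _ ≤ C₁ / c₂ * M.avgASE L noiseVar := by gcongr
      _ ≤ _ := mul_le_mul_of_nonneg_right (le_max_right _ _) hM0
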